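/- Algebras are associative complex algebras, not necessarily unital; $A\sqcup B$ denotes the free product (coproduct) of algebras, $\iota_1,\iota_2$ the embeddings of its factors, $j_1\amalg j_2 : A'\sqcup B'\to A\sqcup B$ the homomorphism induced by $j_1:A'\to A$, $j_2:B'\to B$, $A^{\sqcup m}$ the $m$-fold free product of $A$ with itself, $\mathrm T(V)=\bigoplus_{n\ge 1}V^{\otimes n}$ the non-unital tensor algebra and $\mathrm S(W)$ the (unital) symmetric algebra of a vector space. For a linear map $R:W\to C$ into a commutative unital algebra, $\mathrm S(R):\mathrm S(W)\to C$ is the unital homomorphism extending $R$. $\mathbb N=\{1,2,\dots\}$, $\mathbb N_0=\mathbb N\cup\{0\}$. Let $d,m\in\mathbb N$. A *u.a.u.-product* $\odot$ on $\mathrm{AlgP}_{d,m}$ assigns to algebras $A_1,A_2$, each equipped with an $m$-tuple of subalgebras $(A_i^{(1)},\dots,A_i^{(m)})$ which freely generates it, and to $d$-tuples $\varphi_i$ of linear functionals on $A_i$, a $d$-tuple $\varphi_1\odot\varphi_2$ of linear functionals on $A_1\sqcup A_2$ (equipped with the subalgebras $A_1^{(k)}\sqcup A_2^{(k)}$), such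 that $(\varphi_1\odot\varphi_2)\circ\iota_i=\varphi_i$ for $i=1,2$; $(\varphi_1\odot\varphi_2)\odot\varphi_3=\varphi_1\odot(\varphi_2\odot\varphi_3)$; and $(\varphi_1\odot\varphi_2)\circ(j_1\amalg j_2)=(\varphi_1\circ j_1)\odot(\varphi_2\circ j_2)$ for all algebra homomorphisms $j_1,j_2$ which map the $k$-th distinguished subalgebra into the $k$-th one for each $k$. A *dual semigroup* is an algebra $D$ with a homomorphism $\Delta:D\to D\sqcup D$ such that $(\Delta\amalg\mathrm{id})\circ\Delta=(\mathrm{id}\amalg\Delta)\circ\Delta$, $(0\amalg\mathrm{id})\circ\Delta=\iota_2$ and $(\mathrm{id}\amalg 0)\circ\Delta=\iota_1$. It is *$\mathbb N$-graded* if $D=\bigoplus_{n\ge1}D^{(n)}$ is an $\mathbb N$-graded algebra and $\Delta$ is homogeneous of degree $0$ for the induced grading of $D\sqcup D$. Let $\Delta^{\sqcup m}:D^{\sqcup m}\to D^{\sqcup m}\sqcup D^{\sqcup m}$ be the homomorphism which on the $k$-th copy of $D$ is $\Delta$ followed by the embedding of $D\sqcup D$ as the free product of the two $k$-th copies of $D$.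 **Theorem.** Let $\odot$ be a u.a.u.-product on $\mathrm{AlgP}_{d,m}$. (1) Let $D$ be an $\mathbb N$-graded dual semigroup. There is a unique linear map $\sigma:(D^{\sqcup m}\sqcup D^{\sqcup m})^d\to \mathrm S\bigl((D^{\sqcup m})^d\bigr)\otimes \mathrm S\bigl((D^{\sqcup m})^d\bigr)$ with $\varphi_1\odot\varphi_2=(\mathrm S(\varphi_1)\otimes \mathrm S(\varphi_2))\circ\sigma$ for all $d$-tuples $\varphi_1,\varphi_2$ of linear functionals on $D^{\sqcup m}$ (a $d$-tuple of functionals on $W$ being regarded as a functional on $W^d$), and $$\mathcal L_\odot(D)=\Bigl(\mathrm S\bigl((D^{\sqcup m})^d\bigr),\ \mathrm S(\sigma\circ\Delta^{\sqcup m}),\ \mathrm S(0)\Bigr)$$ is an $\mathbb N_0$-graded bialgebra for the grading induced by that of $D$ (products of homogeneous elements have the sum of the degrees of the factors as degree). (2) Let $V=\bigoplus_{n\ge1}V^{(n)}$ be an $\mathbb N$-graded vector space. Then $\mathrm T(V)$, with the comultiplication determined by $\Delta v=\iota_1 v+\iota_2 v$ for $v\in V$ and with the induced grading, is an $\mathbb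 N$-graded dual semigroup, and $\mathcal L_\odot(\mathrm T(V))$ is an $\mathbb N_0$-graded Hopf algebra (its antipode being homogeneous of degree $0$) whose component of degree $0$ is $\mathbb C\mathbf 1$. -/

import Mathlib

open scoped TensorProduct

universe u

noncomputable section

/-! ## Non-unital algebras

All algebras are associative complex algebras, in general without unit:
`[NonUnitalRing A] [Module ℂ A] [IsScalarTower ℂ A A] [SMulCommClass ℂ A A]`,
and algebra homomorphisms are `A →ₙₐ[ℂ] B`. -/

/-- A unital homomorphism from `U` to the unitization of `B` which maps the set `s` into `B`
restricts to a homomorphism from the non-unital subalgebra generated by `s` to `B`. -/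
def restrictAdjoin {U B : Type*} [Ring U] [Algebra ℂ U]
    [NonUnitalRing B] [Module ℂ B] [IsScalarTower ℂ B B] [SMulCommClass ℂ B B]
    (s : Set U) (F : U →ₐ[ℂ] Unitization ℂ B) (hF : ∀ x ∈ s, (F x).fst = 0) :
    NonUnitalAlgebra.adjoin ℂ s →ₙₐ[ℂ] B :=
  have h0 : ∀ x ∈ NonUnitalAlgebra.adjoin ℂ s, (F x).fst = 0 := fun x hx => by
    induction hx using NonUnitalAlgebra.adjoin_induction with
    | mem x hx => exact hF x hx
    | add x y _ _ hx hy => simp [hx, hy]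
    | zero => simp
    | mul x y _ _ hx hy => simp [hx, hy]
    | smul r x _ hx => simp [hx]
  { toFun := fun x => (F x.1).snd
    map_smul' := fun r x => by simp
    map_zero' := by simp
    map_add' := fun x y => by simp
    map_mul' := fun x y => by simp [h0 x.1 x.2, h0 y.1 y.2] }

/-! ### The free product of a family of algebras -/

section FreeProd

variable {I : Type} [DecidableEq I] (A : I → Type u) [∀ i, NonUnitalRing (A i)]
  [∀ i, Module ℂ (A i)] [∀ i, IsScalarTower ℂ (A i) (A i)] [∀ i, SMulCommClass ℂ (A i) (A i)]

/-- The images of the `A i` in the unital free product of the unitizations of the `A i`. -/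
def freeProdGen : Set (LinearAlgebra.FreeProduct ℂ fun i => Unitization ℂ (A i)) :=
  {x | ∃ i, ∃ a : A i,
    x = LinearAlgebra.FreeProduct.ι ℂ (fun i => Unitization ℂ (A i)) i (a : Unitization ℂ (A i))}

/-- The free product `⊔ i, A i` of (non-unital) algebras: the non-unital subalgebra generated by
the `A i` in the unital free product of their unitizations. It is the coproduct of the `A i` in
the category of algebras, see `FreeProd.lift`, `FreeProd.lift_ι` and `FreeProd.hom_ext`. -/
def FreeProd : Type u := NonUnitalAlgebra.adjoin ℂ (freeProdGen A)

namespace FreeProd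

instance : NonUnitalRing (FreeProd A) :=
  inferInstanceAs (NonUnitalRing (NonUnitalAlgebra.adjoin ℂ (freeProdGen A)))

instance : Module ℂ (FreeProd A) :=
  inferInstanceAs (Module ℂ (NonUnitalAlgebra.adjoin ℂ (freeProdGen A)))

instance : IsScalarTower ℂ (FreeProd A) (FreeProd A) :=
  inferInstanceAs (IsScalarTower ℂ (NonUnitalAlgebra.adjoin ℂ (freeProdGen A))
    (NonUnitalAlgebra.adjoin ℂ (freeProdGen A)))

instance : SMulCommClass ℂ (FreeProd A) (FreeProd A) :=
  inferInstanceAs (SMulCommClass ℂ (NonUnitalAlgebra.adjoin ℂ (freeProdGen A))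
    (NonUnitalAlgebra.adjoin ℂ (freeProdGen A)))

variable {A}

/-- The canonical homomorphism of `A i` into the free product. -/
def ι (i : I) : A i →ₙₐ[ℂ] FreeProd A :=
  NonUnitalAlgHom.codRestrict
    ((LinearAlgebra.FreeProduct.ι ℂ (fun i => Unitization ℂ (A i)) i).toNonUnitalAlgHom.comp
      (Unitization.inrNonUnitalAlgHom ℂ (A i)))
    (NonUnitalAlgebra.adjoin ℂ (freeProdGen A))
    (fun a => NonUnitalAlgebra.subset_adjoin ℂ ⟨i, a, rfl⟩)

variable {B : Type*} [NonUnitalRing B] [Module ℂ B] [IsScalarTower ℂ B B] [SMulCommClass ℂ B B]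

theorem unital_lift_ι (g : ∀ i, Unitization ℂ (A i) →ₐ[ℂ] Unitization ℂ B) (i : I)
    (a : Unitization ℂ (A i)) :
    LinearAlgebra.FreeProduct.lift ℂ (fun i => Unitization ℂ (A i)) (fun {i} => g i)
      (LinearAlgebra.FreeProduct.ι ℂ (fun i => Unitization ℂ (A i)) i a) = g i a :=
  DFunLike.congr_fun (LinearAlgebra.FreeProduct.lift_comp_ι ℂ (fun i => Unitization ℂ (A i))
    (i := i) (fun {i} => g i)) a

/-- The homomorphism `⊔ f i` on the free product given by homomorphisms `f i` on the `A i`. -/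
def lift (f : ∀ i, A i →ₙₐ[ℂ] B) : FreeProd A →ₙₐ[ℂ] B :=
  restrictAdjoin (freeProdGen A)
    (LinearAlgebra.FreeProduct.lift ℂ (fun i => Unitization ℂ (A i))
      (fun {i} => Unitization.lift ((Unitization.inrNonUnitalAlgHom ℂ B).comp (f i))))
    (by
      rintro _ ⟨i, a, rfl⟩
      rw [unital_lift_ι
        (fun i => Unitization.lift ((Unitization.inrNonUnitalAlgHom ℂ B).comp (f i)))]
      simp)

@[simp]
theorem lift_ι (f : ∀ i, A i →ₙₐ[ℂ] B) (i : I) (a : A i) : lift f (ι i a) = f i a := by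
  change (LinearAlgebra.FreeProduct.lift ℂ (fun i => Unitization ℂ (A i))
      (fun {i} => Unitization.lift ((Unitization.inrNonUnitalAlgHom ℂ B).comp (f i)))
      (LinearAlgebra.FreeProduct.ι ℂ (fun i => Unitization ℂ (A i)) i
        (a : Unitization ℂ (A i)))).snd = _
  rw [unital_lift_ι
    (fun i => Unitization.lift ((Unitization.inrNonUnitalAlgHom ℂ B).comp (f i)))]
  simp

theorem hom_ext {f g : FreeProd A →ₙₐ[ℂ] B} (h : ∀ i a, f (ι i a) = g (ι i a)) : f = g := by
  ext ⟨x, hx⟩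
  induction hx using NonUnitalAlgebra.adjoin_induction with
  | mem x hx => obtain ⟨i, a, rfl⟩ := hx; exact h i a
  | add x y hx hy h1 h2 =>
    exact (map_add f ⟨x, hx⟩ ⟨y, hy⟩).trans ((congrArg₂ _ h1 h2).trans (map_add g _ _).symm)
  | zero => exact (map_zero f).trans (map_zero g).symm
  | mul x y hx hy h1 h2 =>
    exact (map_mul f ⟨x, hx⟩ ⟨y, hy⟩).trans ((congrArg₂ _ h1 h2).trans (map_mul g _ _).symm)
  | smul r x hx h1 =>
    exact (map_smul f r ⟨x, hx⟩).trans ((congrArg _ h1).trans (map_smul g _ _).symm)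

theorem ι_injective (i : I) : Function.Injective (ι (A := A) i) := by
  have h : ∀ a : A i, lift (fun k => if e : k = i then e ▸ NonUnitalAlgHom.id ℂ (A k) else 0)
      (ι i a) = a := fun a => by simp
  exact Function.LeftInverse.injective h

end FreeProd

end FreeProd

/-! ### The free product of two algebras -/

/-- The family consisting of the two types `A` and `B`. -/
def PairFam (A B : Type u) : Bool → Type u
  | false => A
  | true => B

section Coprod

variable (A B : Type u)
  [NonUnitalRing A] [Module ℂ A] [IsScalarTower ℂ A A] [SMulCommClass ℂ A A]
  [NonUnitalRing B] [Module ℂ B] [IsScalarTower ℂ B B] [SMulCommClass ℂ B B]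

instance : ∀ i, NonUnitalRing (PairFam A B i)
  | false => inferInstanceAs (NonUnitalRing A)
  | true => inferInstanceAs (NonUnitalRing B)

instance : ∀ i, Module ℂ (PairFam A B i)
  | false => inferInstanceAs (Module ℂ A)
  | true => inferInstanceAs (Module ℂ B)

instance : ∀ i, IsScalarTower ℂ (PairFam A B i) (PairFam A B i)
  | false => inferInstanceAs (IsScalarTower ℂ A A)
  | true => inferInstanceAs (IsScalarTower ℂ B B)

instance : ∀ i, SMulCommClass ℂ (PairFam A B i) (PairFam A B i)
  | false => inferInstanceAs (SMulCommClass ℂ A A)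
  | true => inferInstanceAs (SMulCommClass ℂ B B)

/-- The free product `A ⊔ B` of two algebras. -/
def Coprod : Type u := FreeProd (PairFam A B)

namespace Coprod

instance : NonUnitalRing (Coprod A B) := inferInstanceAs (NonUnitalRing (FreeProd (PairFam A B)))

instance : Module ℂ (Coprod A B) := inferInstanceAs (Module ℂ (FreeProd (PairFam A B)))

instance : IsScalarTower ℂ (Coprod A B) (Coprod A B) :=
  inferInstanceAs (IsScalarTower ℂ (FreeProd (PairFam A B)) (FreeProd (PairFam A B)))

instance : SMulCommClass ℂ (Coprod A B) (Coprod A B) :=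
  inferInstanceAs (SMulCommClass ℂ (FreeProd (PairFam A B)) (FreeProd (PairFam A B)))

variable {A B}

/-- The embedding of the first factor. -/
def inl : A →ₙₐ[ℂ] Coprod A B := FreeProd.ι (A := PairFam A B) false

/-- The embedding of the second factor. -/
def inr : B →ₙₐ[ℂ] Coprod A B := FreeProd.ι (A := PairFam A B) true

section lift

variable {C : Type*} [NonUnitalRing C] [Module ℂ C] [IsScalarTower ℂ C C] [SMulCommClass ℂ C C]

/-- The homomorphism `f ⊔ g : A ⊔ B → C` given by `f : A → C` and `g : B → C`. -/
def lift (f : A →ₙₐ[ℂ] C) (g : B →ₙₐ[ℂ] C) : Coprod A B →ₙₐ[ℂ] C :=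
  FreeProd.lift (A := PairFam A B) fun i => match i with
    | false => f
    | true => g

@[simp]
theorem lift_inl (f : A →ₙₐ[ℂ] C) (g : B →ₙₐ[ℂ] C) (a : A) : lift f g (inl a) = f a :=
  FreeProd.lift_ι (A := PairFam A B) _ false a

@[simp]
theorem lift_inr (f : A →ₙₐ[ℂ] C) (g : B →ₙₐ[ℂ] C) (b : B) : lift f g (inr b) = g b :=
  FreeProd.lift_ι (A := PairFam A B) _ true b

theorem hom_ext {f g : Coprod A B →ₙₐ[ℂ] C} (h₁ : ∀ a, f (inl a) = g (inl a))
    (h₂ : ∀ b, f (inr b) = g (inr b)) : f = g :=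
  FreeProd.hom_ext (A := PairFam A B) fun i => match i with
    | false => h₁
    | true => h₂

end lift

section map

variable {A' B' : Type u}
  [NonUnitalRing A'] [Module ℂ A'] [IsScalarTower ℂ A' A'] [SMulCommClass ℂ A' A']
  [NonUnitalRing B'] [Module ℂ B'] [IsScalarTower ℂ B' B'] [SMulCommClass ℂ B' B']

/-- The homomorphism `j₁ ⨿ j₂ : A ⊔ B → A' ⊔ B'` given by `j₁ : A → A'` and `j₂ : B → B'`. -/
def map (j₁ : A →ₙₐ[ℂ] A') (j₂ : B →ₙₐ[ℂ] B') : Coprod A B →ₙₐ[ℂ] Coprod A' B' :=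
  lift (inl.comp j₁) (inr.comp j₂)

@[simp]
theorem map_inl (j₁ : A →ₙₐ[ℂ] A') (j₂ : B →ₙₐ[ℂ] B') (a : A) :
    map j₁ j₂ (inl a) = inl (j₁ a) := by simp [map]

@[simp]
theorem map_inr (j₁ : A →ₙₐ[ℂ] A') (j₂ : B →ₙₐ[ℂ] B') (b : B) :
    map j₁ j₂ (inr b) = inr (j₂ b) := by simp [map]

end map

/-- The natural identification `A ⊔ (B ⊔ C) → (A ⊔ B) ⊔ C`. -/
def assoc (A B C : Type u)
    [NonUnitalRing A] [Module ℂ A] [IsScalarTower ℂ A A] [SMulCommClass ℂ A A]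
    [NonUnitalRing B] [Module ℂ B] [IsScalarTower ℂ B B] [SMulCommClass ℂ B B]
    [NonUnitalRing C] [Module ℂ C] [IsScalarTower ℂ C C] [SMulCommClass ℂ C C] :
    Coprod A (Coprod B C) →ₙₐ[ℂ] Coprod (Coprod A B) C :=
  lift (inl.comp inl) (lift (inl.comp inr) inr)

end Coprod

end Coprod

/-! ## Universal products -/

/-- An algebra together with an `m`-tuple of subalgebras which freely generates it. -/
structure FacedAlg (m : ℕ) : Type (u + 1) where
  carrier : Type u
  [ring : NonUnitalRing carrier]
  [module : Module ℂ carrier]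
  [tower : IsScalarTower ℂ carrier carrier]
  [comm : SMulCommClass ℂ carrier carrier]
  face : Fin m → NonUnitalSubalgebra ℂ carrier
  freelyGenerates : Function.Bijective
    (FreeProd.lift fun k => NonUnitalSubalgebraClass.subtype (face k) :
      FreeProd (fun k => face k) →ₙₐ[ℂ] carrier)

namespace FacedAlg

instance (m : ℕ) : CoeSort (FacedAlg.{u} m) (Type u) := ⟨FacedAlg.carrier⟩

attribute [instance] FacedAlg.ring FacedAlg.module FacedAlg.tower FacedAlg.comm

variable {m : ℕ}

/-- Homomorphisms which respect the faces. -/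
def RespectsFaces (A B : FacedAlg.{u} m) (j : A →ₙₐ[ℂ] B) : Prop :=
  ∀ k, ∀ a ∈ A.face k, j a ∈ B.face k

/-- Two homomorphisms on a faced algebra agree if they agree on the faces. -/
theorem hom_ext (A : FacedAlg.{u} m) {C : Type*} [NonUnitalRing C] [Module ℂ C]
    [IsScalarTower ℂ C C] [SMulCommClass ℂ C C] {f g : A →ₙₐ[ℂ] C}
    (h : ∀ k, ∀ a ∈ A.face k, f a = g a) : f = g := by
  ext a
  obtain ⟨x, rfl⟩ := A.freelyGenerates.2 a
  have : f.comp (FreeProd.lift fun k => NonUnitalSubalgebraClass.subtype (A.face k)) =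
      g.comp (FreeProd.lift fun k => NonUnitalSubalgebraClass.subtype (A.face k)) :=
    FreeProd.hom_ext fun k a => by simpa using h k a a.2
  exact DFunLike.congr_fun this x

/-- Homomorphisms on the faces extend to a homomorphism on the whole algebra. -/
theorem exists_lift (A : FacedAlg.{u} m) {C : Type*} [NonUnitalRing C] [Module ℂ C]
    [IsScalarTower ℂ C C] [SMulCommClass ℂ C C] (f : ∀ k, A.face k →ₙₐ[ℂ] C) :
    ∃ F : A →ₙₐ[ℂ] C, ∀ k (a : A.face k), F a = f k a := by
  let p : FreeProd (fun k => A.face k) →ₙₐ[ℂ] A :=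
    FreeProd.lift fun k => NonUnitalSubalgebraClass.subtype (A.face k)
  let e := Equiv.ofBijective p A.freelyGenerates
  have he : ∀ x, p (e.symm x) = x := e.apply_symm_apply
  have hp : Function.Injective p := A.freelyGenerates.1
  let q : A →ₙₐ[ℂ] FreeProd (fun k => A.face k) :=
    { toFun := e.symm
      map_smul' := fun r x => hp (by rw [he]; simp [he])
      map_zero' := hp (by rw [he]; simp)
      map_add' := fun x y => hp (by rw [he]; simp [he])
      map_mul' := fun x y => hp (by rw [he]; simp [he]) }
  refine ⟨(FreeProd.lift f).comp q, fun k a => ?_⟩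
  have : q a = FreeProd.ι (A := fun k => A.face k) k a := hp (by
    change p (e.symm a) = _
    rw [he]; simp [p])
  simp [this]

/-- A criterion for free generation. -/
theorem bijective_of {C : Type u} [NonUnitalRing C] [Module ℂ C]
    [IsScalarTower ℂ C C] [SMulCommClass ℂ C C] (F : Fin m → NonUnitalSubalgebra ℂ C)
    (q : C →ₙₐ[ℂ] FreeProd (fun k => F k))
    (h₁ : ∀ k (a : F k), q a = FreeProd.ι (A := fun k => F k) k a)
    (h₂ : (FreeProd.lift fun k => NonUnitalSubalgebraClass.subtype (F k)).comp q =
      NonUnitalAlgHom.id ℂ C) :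
    Function.Bijective (FreeProd.lift fun k => NonUnitalSubalgebraClass.subtype (F k) :
      FreeProd (fun k => F k) →ₙₐ[ℂ] C) := by
  have h₃ : q.comp (FreeProd.lift fun k => NonUnitalSubalgebraClass.subtype (F k)) =
      NonUnitalAlgHom.id ℂ _ := FreeProd.hom_ext fun k a => by simpa using h₁ k a
  exact ⟨Function.LeftInverse.injective (DFunLike.congr_fun h₃),
    Function.RightInverse.surjective (DFunLike.congr_fun h₂)⟩

/-- The `k`-th face of `A ⊔ B` is the subalgebra generated by the `k`-th faces of `A` and `B`. -/
def prodFace (A B : FacedAlg.{u} m) (k : Fin m) : NonUnitalSubalgebra ℂ (Coprod A B) :=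
  NonUnitalAlgebra.adjoin ℂ
    (((Coprod.inl : A →ₙₐ[ℂ] Coprod A B) '' (A.face k : Set A)) ∪
      ((Coprod.inr : B →ₙₐ[ℂ] Coprod A B) '' (B.face k : Set B)))

/-- `A ⊔ B` with the faces `A⁽ᵏ⁾ ⊔ B⁽ᵏ⁾`. -/
def prod (A B : FacedAlg.{u} m) : FacedAlg.{u} m where
  carrier := Coprod A B
  face := prodFace A B
  freelyGenerates := by
    have hl : ∀ k (a : A.face k), Coprod.inl (a : A) ∈ prodFace A B k := fun k a =>
      NonUnitalAlgebra.subset_adjoin ℂ (Or.inl ⟨a, a.2, rfl⟩)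
    have hr : ∀ k (b : B.face k), Coprod.inr (b : B) ∈ prodFace A B k := fun k b =>
      NonUnitalAlgebra.subset_adjoin ℂ (Or.inr ⟨b, b.2, rfl⟩)
    obtain ⟨f, hf⟩ := A.exists_lift fun k =>
      (FreeProd.ι (A := fun k => prodFace A B k) k).comp
        (NonUnitalAlgHom.codRestrict
          ((Coprod.inl : A →ₙₐ[ℂ] Coprod A B).comp
            (NonUnitalSubalgebraClass.subtype (A.face k))) (prodFace A B k) (hl k))
    obtain ⟨g, hg⟩ := B.exists_lift fun k =>
      (FreeProd.ι (A := fun k => prodFace A B k) k).comp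
        (NonUnitalAlgHom.codRestrict
          ((Coprod.inr : B →ₙₐ[ℂ] Coprod A B).comp
            (NonUnitalSubalgebraClass.subtype (B.face k))) (prodFace A B k) (hr k))
    refine bijective_of _ (Coprod.lift f g) ?_ ?_
    · rintro k ⟨x, hx⟩
      induction hx using NonUnitalAlgebra.adjoin_induction with
      | mem x hx =>
        rcases hx with ⟨a, ha, rfl⟩ | ⟨b, hb, rfl⟩
        · exact (Coprod.lift_inl f g a).trans (hf k ⟨a, ha⟩)
        · exact (Coprod.lift_inr f g b).trans (hg k ⟨b, hb⟩)
      | add x y hx hy h1 h2 =>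
        have := map_add (FreeProd.ι (A := fun k => prodFace A B k) k) ⟨x, hx⟩ ⟨y, hy⟩
        rw [← h1, ← h2] at this
        exact (map_add (Coprod.lift f g) x y).trans this.symm
      | zero =>
        exact (map_zero (Coprod.lift f g)).trans
          (map_zero (FreeProd.ι (A := fun k => prodFace A B k) k)).symm
      | mul x y hx hy h1 h2 =>
        have := map_mul (FreeProd.ι (A := fun k => prodFace A B k) k) ⟨x, hx⟩ ⟨y, hy⟩
        rw [← h1, ← h2] at this
        exact (map_mul (Coprod.lift f g) x y).trans this.symm
      | smul r x hx h1 =>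
        have := map_smul (FreeProd.ι (A := fun k => prodFace A B k) k) r ⟨x, hx⟩
        rw [← h1] at this
        exact (map_smul (Coprod.lift f g) r x).trans this.symm
    · refine Coprod.hom_ext (fun a => ?_) (fun b => ?_)
      · have : ((FreeProd.lift fun k => NonUnitalSubalgebraClass.subtype (prodFace A B k)).comp
            f) = Coprod.inl := A.hom_ext fun k a ha => by
          exact (congrArg (FreeProd.lift fun k =>
            NonUnitalSubalgebraClass.subtype (prodFace A B k)) (hf k ⟨a, ha⟩)).trans
            (FreeProd.lift_ι _ k _)
        simpa using DFunLike.congr_fun this a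
      · have : ((FreeProd.lift fun k => NonUnitalSubalgebraClass.subtype (prodFace A B k)).comp
            g) = Coprod.inr := B.hom_ext fun k b hb => by
          exact (congrArg (FreeProd.lift fun k =>
            NonUnitalSubalgebraClass.subtype (prodFace A B k)) (hg k ⟨b, hb⟩)).trans
            (FreeProd.lift_ι _ k _)
        simpa using DFunLike.congr_fun this b

/-- The `m`-fold free product `D^{⊔ m}` of an algebra with itself; its faces are the `m` copies
of `D`. -/
def power (m : ℕ) (D : Type u) [NonUnitalRing D] [Module ℂ D] [IsScalarTower ℂ D D]
    [SMulCommClass ℂ D D] : FacedAlg.{u} m where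
  carrier := FreeProd fun _ : Fin m => D
  face k := NonUnitalAlgHom.range (FreeProd.ι (A := fun _ : Fin m => D) k)
  freelyGenerates := by
    refine bijective_of _ (FreeProd.lift fun k =>
      (FreeProd.ι (A := fun k =>
        NonUnitalAlgHom.range (FreeProd.ι (A := fun _ : Fin m => D) k)) k).comp
        (NonUnitalAlgHom.codRestrict (FreeProd.ι (A := fun _ : Fin m => D) k) _
          fun a => ⟨a, rfl⟩)) ?_ ?_
    · rintro k ⟨_, a, rfl⟩
      exact FreeProd.lift_ι (A := fun _ : Fin m => D) _ k a
    · refine FreeProd.hom_ext fun k a => ?_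
      simp only [NonUnitalAlgHom.comp_apply, FreeProd.lift_ι]
      rfl

end FacedAlg

/-- `d`-tuples of linear functionals. -/
abbrev DualTuple (d : ℕ) (W : Type*) [AddCommGroup W] [Module ℂ W] : Type _ :=
  Fin d → (W →ₗ[ℂ] ℂ)

/-- The `d`-tuple `φ ∘ j`. -/
def DualTuple.comp {d : ℕ} {A B : Type*} [NonUnitalRing A] [Module ℂ A]
    [NonUnitalRing B] [Module ℂ B] (φ : DualTuple d A) (j : B →ₙₐ[ℂ] A) : DualTuple d B :=
  fun l => φ l ∘ₗ (j : B →ₗ[ℂ] A)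

/-- A `d`-tuple of linear functionals on `W` as one linear functional on `W^d`. -/
def DualTuple.total {d : ℕ} {W : Type*} [AddCommGroup W] [Module ℂ W] (φ : DualTuple d W) :
    (Fin d → W) →ₗ[ℂ] ℂ :=
  ∑ l, φ l ∘ₗ LinearMap.proj l

/-- Unital associative universal products on the category of algebras with `m` freely generating
subalgebras and `d` linear functionals. -/
structure UAUProduct (d m : ℕ) : Type (u + 1) where
  /-- the `d`-tuple `φ₁ ⊙ φ₂` on `A ⊔ B` -/
  prod : ∀ (A B : FacedAlg.{u} m), DualTuple d A → DualTuple d B → DualTuple d (A.prod B)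
  unital_left : ∀ (A B : FacedAlg.{u} m) (φ₁ : DualTuple d A) (φ₂ : DualTuple d B),
    (prod A B φ₁ φ₂).comp (Coprod.inl : A →ₙₐ[ℂ] Coprod A B) = φ₁
  unital_right : ∀ (A B : FacedAlg.{u} m) (φ₁ : DualTuple d A) (φ₂ : DualTuple d B),
    (prod A B φ₁ φ₂).comp (Coprod.inr : B →ₙₐ[ℂ] Coprod A B) = φ₂
  associative : ∀ (A B C : FacedAlg.{u} m)
    (φ₁ : DualTuple d A) (φ₂ : DualTuple d B) (φ₃ : DualTuple d C),
    (prod (A.prod B) C (prod A B φ₁ φ₂) φ₃).comp (Coprod.assoc A B C) =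
      prod A (B.prod C) φ₁ (prod B C φ₂ φ₃)
  universal : ∀ (A B A' B' : FacedAlg.{u} m) (j₁ : A' →ₙₐ[ℂ] A) (j₂ : B' →ₙₐ[ℂ] B),
    FacedAlg.RespectsFaces A' A j₁ → FacedAlg.RespectsFaces B' B j₂ →
    ∀ (φ₁ : DualTuple d A) (φ₂ : DualTuple d B),
      (prod A B φ₁ φ₂).comp (Coprod.map j₁ j₂) = prod A' B' (φ₁.comp j₁) (φ₂.comp j₂)

/-! ## Dual semigroups -/

/-- The structure of a dual semigroup on an algebra `D`; the counit is `0 : D → {0}`. -/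
structure DualSemigroup (D : Type u) [NonUnitalRing D] [Module ℂ D] [IsScalarTower ℂ D D]
    [SMulCommClass ℂ D D] where
  Δ : D →ₙₐ[ℂ] Coprod D D
  coassoc : (Coprod.map Δ (NonUnitalAlgHom.id ℂ D)).comp Δ =
    (Coprod.assoc D D D).comp ((Coprod.map (NonUnitalAlgHom.id ℂ D) Δ).comp Δ)
  counit_left : (Coprod.map (0 : D →ₙₐ[ℂ] D) (NonUnitalAlgHom.id ℂ D)).comp Δ = Coprod.inr
  counit_right : (Coprod.map (NonUnitalAlgHom.id ℂ D) (0 : D →ₙₐ[ℂ] D)).comp Δ = Coprod.inl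

section Grading

variable {A : Type*} [NonUnitalRing A] [Module ℂ A]

/-- `ProductOfDegree G n a`: the element `a` is a product of elements of the sets `G i`, and the
degrees `i` of the factors add up to `n`. -/
inductive ProductOfDegree (G : ℕ+ → Set A) : ℕ+ → A → Prop
  | of {n : ℕ+} {a : A} : a ∈ G n → ProductOfDegree G n a
  | mul {n k : ℕ+} {a b : A} : ProductOfDegree G n a → ProductOfDegree G k b →
      ProductOfDegree G (n + k) (a * b)

/-- The linear span of the products of total degree `n`. -/
def generatedGrading (G : ℕ+ → Set A) (n : ℕ+) : Submodule ℂ A :=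
  Submodule.span ℂ {a | ProductOfDegree G n a}

/-- `ℕ`-graded algebras, `ℕ = {1, 2, …}`. -/
structure IsGradedAlg (𝒜 : ℕ+ → Submodule ℂ A) : Prop where
  isInternal : DirectSum.IsInternal 𝒜
  mul_mem : ∀ {n k : ℕ+} {a b : A}, a ∈ 𝒜 n → b ∈ 𝒜 k → a * b ∈ 𝒜 (n + k)

end Grading

section Graded

variable {D : Type u} [NonUnitalRing D] [Module ℂ D] [IsScalarTower ℂ D D] [SMulCommClass ℂ D D]

/-- The grading of `D ⊔ D` induced by a grading of `D`. -/
def coprodGrading (𝒟 : ℕ+ → Submodule ℂ D) : ℕ+ → Submodule ℂ (Coprod D D) :=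
  generatedGrading fun n => (Coprod.inl : D →ₙₐ[ℂ] Coprod D D) '' (𝒟 n : Set D) ∪
    (Coprod.inr : D →ₙₐ[ℂ] Coprod D D) '' (𝒟 n : Set D)

/-- The grading of `D^{⊔ m}` induced by a grading of `D`. -/
def powerGrading (m : ℕ) (𝒟 : ℕ+ → Submodule ℂ D) : ℕ+ → Submodule ℂ (FacedAlg.power m D) :=
  generatedGrading (A := FreeProd fun _ : Fin m => D) fun n =>
    {x | ∃ k, ∃ a ∈ 𝒟 n, x = FreeProd.ι (A := fun _ : Fin m => D) k a}

/-- `ℕ`-graded dual semigroups: `D` is a graded algebra and `Δ` is homogeneous of degree `0`. -/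
structure DualSemigroup.IsGraded (S : DualSemigroup D) (𝒟 : ℕ+ → Submodule ℂ D) : Prop where
  isGradedAlg : IsGradedAlg 𝒟
  comul_mem : ∀ n, ∀ a ∈ 𝒟 n, S.Δ a ∈ coprodGrading 𝒟 n

/-- The comultiplication `Δ^{⊔ m} : D^{⊔ m} → D^{⊔ m} ⊔ D^{⊔ m}`; on the `k`-th copy of `D` it is
`Δ`, followed by the embedding of `D ⊔ D` into the `k`-th face of `D^{⊔ m} ⊔ D^{⊔ m}`. -/
def DualSemigroup.powerΔ (S : DualSemigroup D) (m : ℕ) :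
    FacedAlg.power m D →ₙₐ[ℂ] (FacedAlg.power m D).prod (FacedAlg.power m D) :=
  FreeProd.lift (A := fun _ : Fin m => D)
    (B := Coprod (FreeProd fun _ : Fin m => D) (FreeProd fun _ : Fin m => D)) fun k =>
    (Coprod.map (FreeProd.ι (A := fun _ : Fin m => D) k)
      (FreeProd.ι (A := fun _ : Fin m => D) k)).comp S.Δ

end Graded

/-! ## The bialgebra of a dual semigroup and a universal product -/

/-- The grading of the symmetric algebra `S(W)` induced by an `ℕ`-grading of `W`: a product
`w₁ ⋯ wᵣ`, `r ≥ 0`, of homogeneous elements of `W` has degree `deg w₁ + ⋯ + deg wᵣ`. -/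
def symGrading {W : Type*} [AddCommGroup W] [Module ℂ W] (𝒲 : ℕ+ → Submodule ℂ W) (n : ℕ) :
    Submodule ℂ (SymmetricAlgebra ℂ W) :=
  Submodule.span ℂ {x | ∃ (r : ℕ) (deg : Fin r → ℕ+) (w : Fin r → W),
    (∀ i, w i ∈ 𝒲 (deg i)) ∧ ∑ i, (deg i : ℕ) = n ∧ x = ∏ i, SymmetricAlgebra.ι ℂ W (w i)}

namespace UAUProduct

variable {d m : ℕ} (P : UAUProduct.{u} d m)

/-- `σ` is a linear map `(A ⊔ B)^d → S(A^d) ⊗ S(B^d)` with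
`φ₁ ⊙ φ₂ = (S(φ₁) ⊗ S(φ₂)) ∘ σ` for all `φ₁`, `φ₂`. -/
def IsSigma (A B : FacedAlg.{u} m) (σ : (Fin d → A.prod B) →ₗ[ℂ]
    SymmetricAlgebra ℂ (Fin d → A) ⊗[ℂ] SymmetricAlgebra ℂ (Fin d → B)) : Prop :=
  ∀ (φ₁ : DualTuple d A) (φ₂ : DualTuple d B) (x : Fin d → A.prod B),
    (P.prod A B φ₁ φ₂).total x =
      Algebra.TensorProduct.lmul' ℂ (Algebra.TensorProduct.map
        (SymmetricAlgebra.lift φ₁.total) (SymmetricAlgebra.lift φ₂.total) (σ x))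

open Classical in
/-- A map `σ` with `φ₁ ⊙ φ₂ = (S(φ₁) ⊗ S(φ₂)) ∘ σ` for all `φ₁`, `φ₂`, and `0` if there is none. -/
def sigma (A B : FacedAlg.{u} m) : (Fin d → A.prod B) →ₗ[ℂ]
    SymmetricAlgebra ℂ (Fin d → A) ⊗[ℂ] SymmetricAlgebra ℂ (Fin d → B) :=
  if h : ∃ σ, P.IsSigma A B σ then h.choose else 0

end UAUProduct

section Lachs

variable (d m : ℕ) (D : Type u) [NonUnitalRing D] [Module ℂ D] [IsScalarTower ℂ D D]
  [SMulCommClass ℂ D D]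

/-- The algebra `S((D^{⊔ m})^d)`. -/
abbrev LachsAlg : Type u := SymmetricAlgebra ℂ (Fin d → FacedAlg.power m D)

/-- The counit `S(0)`. -/
def lachsCounit : LachsAlg d m D →ₐ[ℂ] ℂ := SymmetricAlgebra.lift 0

variable {d m D}

/-- The comultiplication `S(σ ∘ Δ^{⊔ m})`. -/
def lachsComul (P : UAUProduct.{u} d m) (S : DualSemigroup D) :
    LachsAlg d m D →ₐ[ℂ] LachsAlg d m D ⊗[ℂ] LachsAlg d m D :=
  SymmetricAlgebra.lift (P.sigma (FacedAlg.power m D) (FacedAlg.power m D) ∘ₗ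
    (S.powerΔ m : FacedAlg.power m D →ₗ[ℂ]
      (FacedAlg.power m D).prod (FacedAlg.power m D)).compLeft (Fin d))

/-- The `ℕ₀`-grading of `S((D^{⊔ m})^d)` induced by an `ℕ`-grading of `D`. -/
def lachsGrading (d m : ℕ) (𝒟 : ℕ+ → Submodule ℂ D) : ℕ → Submodule ℂ (LachsAlg d m D) :=
  symGrading fun n => Submodule.pi Set.univ fun _ : Fin d => powerGrading m 𝒟 n

end Lachs

/-! ## Graded bialgebras and Hopf algebras -/

section Bialgebra

variable {B : Type*} [CommRing B] [Algebra ℂ B]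

/-- The algebra `B` is a bialgebra with comultiplication `Δ` and counit `ε`. -/
structure IsBialgebra (Δ : B →ₐ[ℂ] B ⊗[ℂ] B) (ε : B →ₐ[ℂ] ℂ) : Prop where
  coassoc : (Algebra.TensorProduct.assoc ℂ ℂ ℂ B B B).toAlgHom.comp
      ((Algebra.TensorProduct.map Δ (AlgHom.id ℂ B)).comp Δ) =
    (Algebra.TensorProduct.map (AlgHom.id ℂ B) Δ).comp Δ
  counit_left : (Algebra.TensorProduct.lid ℂ B).toAlgHom.comp
      ((Algebra.TensorProduct.map ε (AlgHom.id ℂ B)).comp Δ) = AlgHom.id ℂ B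
  counit_right : (Algebra.TensorProduct.rid ℂ ℂ B).toAlgHom.comp
      ((Algebra.TensorProduct.map (AlgHom.id ℂ B) ε).comp Δ) = AlgHom.id ℂ B

/-- The subspace `⊕_{k + l = n} B⁽ᵏ⁾ ⊗ B⁽ˡ⁾` of `B ⊗ B`. -/
def tensorDegree (ℬ : ℕ → Submodule ℂ B) (n : ℕ) : Submodule ℂ (B ⊗[ℂ] B) :=
  ⨆ p ∈ Finset.HasAntidiagonal.antidiagonal n,
    LinearMap.range (TensorProduct.map (ℬ p.1).subtype (ℬ p.2).subtype)

/-- `ℕ₀`-graded bialgebras. -/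
structure IsGradedBialgebra (ℬ : ℕ → Submodule ℂ B) (Δ : B →ₐ[ℂ] B ⊗[ℂ] B) (ε : B →ₐ[ℂ] ℂ) :
    Prop where
  isBialgebra : IsBialgebra Δ ε
  isInternal : DirectSum.IsInternal ℬ
  gradedMonoid : SetLike.GradedMonoid ℬ
  comul_mem : ∀ n, ∀ b ∈ ℬ n, Δ b ∈ tensorDegree ℬ n
  counit_eq_zero : ∀ n, n ≠ 0 → ∀ b ∈ ℬ n, ε b = 0

/-- `ℕ₀`-graded Hopf algebras: there is an antipode, and it is homogeneous of degree `0`. -/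
structure IsGradedHopfAlgebra (ℬ : ℕ → Submodule ℂ B) (Δ : B →ₐ[ℂ] B ⊗[ℂ] B) (ε : B →ₐ[ℂ] ℂ) :
    Prop where
  isGradedBialgebra : IsGradedBialgebra ℬ Δ ε
  exists_antipode : ∃ α : B →ₗ[ℂ] B,
    LinearMap.mul' ℂ B ∘ₗ α.rTensor B ∘ₗ Δ.toLinearMap =
      Algebra.linearMap ℂ B ∘ₗ ε.toLinearMap ∧
    LinearMap.mul' ℂ B ∘ₗ α.lTensor B ∘ₗ Δ.toLinearMap =
      Algebra.linearMap ℂ B ∘ₗ ε.toLinearMap ∧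
    ∀ n, ∀ b ∈ ℬ n, α b ∈ ℬ n

end Bialgebra

/-! ## The dual semigroup `T(V)` -/

section Tensor

variable (V : Type u) [AddCommGroup V] [Module ℂ V]

/-- The non-unital tensor algebra `T(V) = ⊕_{n ≥ 1} V^{⊗ n}`: the non-unital subalgebra
generated by `V` in the unital tensor algebra. -/
def NTensor : Type u :=
  NonUnitalAlgebra.adjoin ℂ (Set.range (TensorAlgebra.ι ℂ : V →ₗ[ℂ] TensorAlgebra ℂ V))

namespace NTensor

instance : NonUnitalRing (NTensor V) := inferInstanceAs (NonUnitalRing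
  (NonUnitalAlgebra.adjoin ℂ (Set.range (TensorAlgebra.ι ℂ : V →ₗ[ℂ] TensorAlgebra ℂ V))))

instance : Module ℂ (NTensor V) := inferInstanceAs (Module ℂ
  (NonUnitalAlgebra.adjoin ℂ (Set.range (TensorAlgebra.ι ℂ : V →ₗ[ℂ] TensorAlgebra ℂ V))))

instance : IsScalarTower ℂ (NTensor V) (NTensor V) := inferInstanceAs (IsScalarTower ℂ
  (NonUnitalAlgebra.adjoin ℂ (Set.range (TensorAlgebra.ι ℂ : V →ₗ[ℂ] TensorAlgebra ℂ V)))
  (NonUnitalAlgebra.adjoin ℂ (Set.range (TensorAlgebra.ι ℂ : V →ₗ[ℂ] TensorAlgebra ℂ V))))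

instance : SMulCommClass ℂ (NTensor V) (NTensor V) := inferInstanceAs (SMulCommClass ℂ
  (NonUnitalAlgebra.adjoin ℂ (Set.range (TensorAlgebra.ι ℂ : V →ₗ[ℂ] TensorAlgebra ℂ V)))
  (NonUnitalAlgebra.adjoin ℂ (Set.range (TensorAlgebra.ι ℂ : V →ₗ[ℂ] TensorAlgebra ℂ V))))

variable {V}

/-- The embedding of `V` into `T(V)`. -/
def ι : V →ₗ[ℂ] NTensor V where
  toFun v := ⟨TensorAlgebra.ι ℂ v, NonUnitalAlgebra.subset_adjoin ℂ ⟨v, rfl⟩⟩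
  map_add' v w := Subtype.ext (map_add (TensorAlgebra.ι ℂ) v w)
  map_smul' r v := Subtype.ext (map_smul (TensorAlgebra.ι ℂ) r v)

variable {B : Type*} [NonUnitalRing B] [Module ℂ B] [IsScalarTower ℂ B B] [SMulCommClass ℂ B B]

/-- The homomorphism `T(R) : T(V) → B` given by a linear map `R : V → B`. -/
def lift (R : V →ₗ[ℂ] B) : NTensor V →ₙₐ[ℂ] B :=
  restrictAdjoin (Set.range (TensorAlgebra.ι ℂ : V →ₗ[ℂ] TensorAlgebra ℂ V))
    (TensorAlgebra.lift ℂ ((Unitization.inrNonUnitalAlgHom ℂ B : B →ₗ[ℂ] Unitization ℂ B) ∘ₗ R))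
    (by rintro _ ⟨v, rfl⟩; simp)

@[simp]
theorem lift_ι (R : V →ₗ[ℂ] B) (v : V) : lift R (ι v) = R v := by
  change (TensorAlgebra.lift ℂ
    ((Unitization.inrNonUnitalAlgHom ℂ B : B →ₗ[ℂ] Unitization ℂ B) ∘ₗ R)
    (TensorAlgebra.ι ℂ v)).snd = _
  simp

theorem hom_ext {f g : NTensor V →ₙₐ[ℂ] B} (h : ∀ v, f (ι v) = g (ι v)) : f = g := by
  ext ⟨x, hx⟩
  induction hx using NonUnitalAlgebra.adjoin_induction with
  | mem x hx => obtain ⟨v, rfl⟩ := hx; exact h v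
  | add x y hx hy h1 h2 =>
    exact (map_add f ⟨x, hx⟩ ⟨y, hy⟩).trans ((congrArg₂ _ h1 h2).trans (map_add g _ _).symm)
  | zero => exact (map_zero f).trans (map_zero g).symm
  | mul x y hx hy h1 h2 =>
    exact (map_mul f ⟨x, hx⟩ ⟨y, hy⟩).trans ((congrArg₂ _ h1 h2).trans (map_mul g _ _).symm)
  | smul r x hx h1 =>
    exact (map_smul f r ⟨x, hx⟩).trans ((congrArg _ h1).trans (map_smul g _ _).symm)

/-- The grading of `T(V)` induced by an `ℕ`-grading of `V`. -/
def grading (𝒱 : ℕ+ → Submodule ℂ V) : ℕ+ → Submodule ℂ (NTensor V) :=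
  generatedGrading fun n => ι '' (𝒱 n : Set V)

variable (V)

/-- The comultiplication of `T(V)`, with `Δ v = ι₁ v + ι₂ v` for `v ∈ V`. -/
def comul : NTensor V →ₙₐ[ℂ] Coprod (NTensor V) (NTensor V) :=
  lift (((Coprod.inl : NTensor V →ₙₐ[ℂ] Coprod (NTensor V) (NTensor V)) :
      NTensor V →ₗ[ℂ] Coprod (NTensor V) (NTensor V)) ∘ₗ ι +
    ((Coprod.inr : NTensor V →ₙₐ[ℂ] Coprod (NTensor V) (NTensor V)) :
      NTensor V →ₗ[ℂ] Coprod (NTensor V) (NTensor V)) ∘ₗ ι)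

@[simp]
theorem comul_ι (v : V) : comul V (ι v) = Coprod.inl (ι v) + Coprod.inr (ι v) := by
  simp [comul]

/-- The dual semigroup `T(V)`. -/
def dualSemigroup : DualSemigroup (NTensor V) where
  Δ := comul V
  coassoc := hom_ext fun v => by simp [Coprod.assoc, add_assoc]
  counit_left := hom_ext fun v => by simp
  counit_right := hom_ext fun v => by simp

end NTensor

end Tensor

end

/-! The heart of the matter is that `φ₁ ⊙ φ₂`, evaluated at a fixed element, is a polynomial in
finitely many values of the components of `φ₁` and `φ₂`. By linearity the element may be taken to be
a word in elements of the faces. By universality (`prod_word_eq`) its value can be computed in free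
algebras on coloured letters, where it is a function of the values of the functionals on words, and
repeated letters may be made distinct (`exists_multilinear_word`). For a word `w` in which each
letter occurs exactly once, substitutions now determine the shape of this function. Rescaling a
letter gives homogeneity (`wordValue_scale`), and splitting a letter into a sum of two gives
additivity (`wordValue_add`). Consequently words with a repeated letter are irrelevant as variables,
which leaves finitely many variables, and the function is affine in each of them: it is a
polynomial.

Characters `S(φ)` separate the points of `S(W^d)`, and pairs of them separate the points of a tensor
product. So an element of `S(A^d) ⊗ S(B^d)` is the same as the polynomial function it defines, which
gives `σ` and its uniqueness. The bialgebra axioms can likewise be tested on characters, where they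
say that the convolution `(φ₁ ⊙ φ₂) ∘ Δ^{⊔ m}` is associative with unit `0`.

Gradings are handled by the dilation `θ` that multiplies degree `n` by `2 ^ n`. The powers of `2`
are distinct, so a spanning family of subspaces on which a dilation acts in this way is
automatically a direct decomposition into eigenspaces, and homogeneity of a linear map amounts to
commuting with dilations. On a graded algebra `θ` is a homomorphism, so universality carries it
through `⊙`.

For `T(V)` the bialgebra is connected because generators have positive degree. The antipode is then
the geometric series for the convolution inverse of the identity, which is a finite sum in each
degree. -/

noncomputable section

/-! ## Words -/

section Words

/-- The number of occurrences of a letter in a word. -/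
def letterCount {X : Type*} [DecidableEq X] (x : X) (w : FreeSemigroup X) : ℕ :=
  (w.head :: w.tail).count x

section letterCount

variable {X : Type*} [DecidableEq X]

@[simp]
theorem letterCount_mul (x : X) (v w : FreeSemigroup X) :
    letterCount x (v * w) = letterCount x v + letterCount x w := by
  simp only [letterCount, FreeSemigroup.head_mul, FreeSemigroup.tail_mul]
  rw [← List.count_append, List.cons_append]

theorem letterCount_of (x y : X) :
    letterCount x (FreeSemigroup.of y) = if y = x then 1 else 0 := by
  simp [letterCount, FreeSemigroup.of, List.count_singleton]

theorem exists_letterCount_pos (w : FreeSemigroup X) : ∃ x, 0 < letterCount x w :=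
  ⟨w.head, by simp [letterCount]⟩

theorem finite_letterCount_le_one [Finite X] :
    {w : FreeSemigroup X | ∀ x, letterCount x w ≤ 1}.Finite := by
  have := Fintype.ofFinite X
  have hf : {l : List X | l.Nodup}.Finite :=
    (List.finite_length_le X (Fintype.card X)).subset fun l hl => hl.length_le_card
  have hi : Function.Injective fun w : FreeSemigroup X => w.head :: w.tail := by
    rintro ⟨a, l⟩ ⟨b, k⟩ h
    simpa using h
  refine (hf.preimage hi.injOn).subset fun w hw => ?_
  exact List.nodup_iff_count_le_one.2 hw

theorem lift_congr_of_letterCount_eq_zero {C : Type*} [Semigroup C] {g g' : X → C} {x : X}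
    (h : ∀ y, y ≠ x → g y = g' y) (w : FreeSemigroup X) (hw : letterCount x w = 0) :
    FreeSemigroup.lift g w = FreeSemigroup.lift g' w := by
  induction w using FreeSemigroup.recOnMul with
  | ih1 y =>
    rw [letterCount_of] at hw
    simpa using h y (by intro e; simp [e] at hw)
  | ih2 y w h1 h2 =>
    rw [letterCount_mul] at hw
    rw [map_mul, map_mul, h1 (by omega), h2 (by omega)]

/-- The value of a word depends linearly on a letter which occurs exactly once. -/
theorem exists_linear_of_letterCount_eq_one {C : Type*} [NonUnitalRing C] [Module ℂ C]
    [IsScalarTower ℂ C C] [SMulCommClass ℂ C C] (g : X → C) (x : X) (w : FreeSemigroup X)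
    (hw : letterCount x w = 1) :
    ∃ L : C →ₗ[ℂ] C, ∀ a, FreeSemigroup.lift (Function.update g x a) w = L a := by
  have h0 : ∀ a, ∀ w, letterCount x w = 0 →
      FreeSemigroup.lift (Function.update g x a) w = FreeSemigroup.lift g w := fun a w hw =>
    lift_congr_of_letterCount_eq_zero (fun y hy => by simp [hy]) w hw
  induction w using FreeSemigroup.recOnMul with
  | ih1 y =>
    rw [letterCount_of] at hw
    obtain rfl : y = x := by by_contra e; simp [e] at hw
    exact ⟨LinearMap.id, fun a => by simp⟩
  | ih2 y w h1 h2 =>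
    rw [letterCount_mul] at hw
    rcases Nat.eq_zero_or_pos (letterCount x w) with h | h
    · obtain ⟨L, hL⟩ := h1 (by omega)
      exact ⟨LinearMap.mulRight ℂ (FreeSemigroup.lift g w) ∘ₗ L, fun a => by
        rw [map_mul, hL, h0 a w h]; rfl⟩
    · obtain ⟨L, hL⟩ := h2 (by omega)
      exact ⟨LinearMap.mulLeft ℂ (FreeSemigroup.lift g (FreeSemigroup.of y)) ∘ₗ L, fun a => by
        rw [map_mul, hL, h0 a _ (by omega)]; rfl⟩

end letterCount

/-- Each word is obtained by a substitution from a word in which each letter occurs once. -/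
theorem exists_multilinear_word {Y : Type u} (w : FreeSemigroup Y) :
    ∃ (X : Type u) (_ : Finite X) (_ : DecidableEq X) (g : X → Y) (v : FreeSemigroup X),
      (∀ x, letterCount x v = 1) ∧ FreeSemigroup.map g v = w := by
  classical
  induction w using FreeSemigroup.recOnMul with
  | ih1 y =>
    exact ⟨PUnit, inferInstance, inferInstance, fun _ => y, FreeSemigroup.of PUnit.unit,
      fun x => by simp [letterCount_of], rfl⟩
  | ih2 y w h1 h2 =>
    obtain ⟨X₁, _, _, g₁, v₁, hv₁, e₁⟩ := h1
    obtain ⟨X₂, _, _, g₂, v₂, hv₂, e₂⟩ := h2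
    have hl : ∀ (x : X₁) v, letterCount (Sum.inl x : X₁ ⊕ X₂) (FreeSemigroup.map Sum.inl v) =
        letterCount x v := fun x v => by
      induction v using FreeSemigroup.recOnMul <;> simp_all [letterCount_of]
    have hl0 : ∀ (x : X₂) v, letterCount (Sum.inr x : X₁ ⊕ X₂) (FreeSemigroup.map Sum.inl v) =
        0 := fun x v => by
      induction v using FreeSemigroup.recOnMul <;> simp_all [letterCount_of]
    have hr : ∀ (x : X₂) v, letterCount (Sum.inr x : X₁ ⊕ X₂) (FreeSemigroup.map Sum.inr v) =
        letterCount x v := fun x v => by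
      induction v using FreeSemigroup.recOnMul <;> simp_all [letterCount_of]
    have hr0 : ∀ (x : X₁) v, letterCount (Sum.inl x : X₁ ⊕ X₂) (FreeSemigroup.map Sum.inr v) =
        0 := fun x v => by
      induction v using FreeSemigroup.recOnMul <;> simp_all [letterCount_of]
    have m1 : ∀ v, FreeSemigroup.map (Sum.elim g₁ g₂) (FreeSemigroup.map Sum.inl v) =
        FreeSemigroup.map g₁ v := fun v => by
      induction v using FreeSemigroup.recOnMul <;> simp_all
    have m2 : ∀ v, FreeSemigroup.map (Sum.elim g₁ g₂) (FreeSemigroup.map Sum.inr v) =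
        FreeSemigroup.map g₂ v := fun v => by
      induction v using FreeSemigroup.recOnMul <;> simp_all
    -- The disjoint union keeps the occurrences in the two factors apart even when they are the same
    -- letter of `Y`.
    refine ⟨X₁ ⊕ X₂, inferInstance, inferInstance, Sum.elim g₁ g₂,
      FreeSemigroup.map Sum.inl v₁ * FreeSemigroup.map Sum.inr v₂, ?_, ?_⟩
    · rintro (x | x)
      · rw [letterCount_mul, hl, hr0, hv₁]
      · rw [letterCount_mul, hl0, hr, hv₂]
    · rw [map_mul, m1, m2, e₁, e₂]

end Words

/-! ## The free algebra on a set of coloured letters -/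

/-- The free (non-unital) algebra on a set of letters. -/
abbrev WordAlg (X : Type*) : Type _ := MonoidAlgebra ℂ (FreeSemigroup X)

namespace WordAlg

variable {X : Type*}

/-- A word as an element of the free algebra. -/
def word (w : FreeSemigroup X) : WordAlg X := MonoidAlgebra.single w 1

theorem word_mul (v w : FreeSemigroup X) : word (v * w) = word v * word w := by
  simp [word, MonoidAlgebra.single_mul_single]

/-- The letters of the free algebra. -/
def letter (x : X) : WordAlg X := word (FreeSemigroup.of x)

theorem hom_ext {A : Type*} [NonUnitalRing A] [Module ℂ A] {f g : WordAlg X →ₙₐ[ℂ] A}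
    (h : ∀ x, f (letter x) = g (letter x)) : f = g := by
  refine MonoidAlgebra.nonUnitalAlgHom_ext ℂ fun w => ?_
  change f (word w) = g (word w)
  induction w using FreeSemigroup.recOnMul with
  | ih1 x => exact h x
  | ih2 x w h1 h2 => rw [word_mul, map_mul, map_mul, h1, h2]

section lift

variable {A : Type*} [NonUnitalRing A] [Module ℂ A] [IsScalarTower ℂ A A] [SMulCommClass ℂ A A]

/-- The homomorphism given by the values of the letters. -/
def lift (a : X → A) : WordAlg X →ₙₐ[ℂ] A := MonoidAlgebra.liftMagma ℂ (FreeSemigroup.lift a)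

@[simp]
theorem lift_word (a : X → A) (w : FreeSemigroup X) :
    lift a (word w) = FreeSemigroup.lift a w := by
  simp [lift, word]

@[simp]
theorem lift_letter (a : X → A) (x : X) : lift a (letter x) = a x := by
  simp [letter]

end lift

/-- The linear functional with given values on the words. -/
def functional (u : FreeSemigroup X → ℂ) : WordAlg X →ₗ[ℂ] ℂ :=
  (MonoidAlgebra.basis (FreeSemigroup X) ℂ).constr ℂ u

theorem basis_apply (w : FreeSemigroup X) :
    MonoidAlgebra.basis (FreeSemigroup X) ℂ w = word w := by
  simp [word]

@[simp]
theorem functional_word (u : FreeSemigroup X → ℂ) (w : FreeSemigroup X) :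
    functional u (word w) = u w := by
  rw [← basis_apply, functional, Module.Basis.constr_basis]

theorem functional_ext {f g : WordAlg X →ₗ[ℂ] ℂ} (h : ∀ w, f (word w) = g (word w)) : f = g :=
  (MonoidAlgebra.basis (FreeSemigroup X) ℂ).ext fun w => by rw [basis_apply]; exact h w

variable {m : ℕ}

/-- The subalgebra generated by the letters of a given colour. -/
def face (c : X → Fin m) (k : Fin m) : NonUnitalSubalgebra ℂ (WordAlg X) :=
  NonUnitalAlgebra.adjoin ℂ (letter '' (c ⁻¹' {k}))

theorem letter_mem_face (c : X → Fin m) (x : X) : letter x ∈ face c (c x) :=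
  NonUnitalAlgebra.subset_adjoin ℂ ⟨x, rfl, rfl⟩

theorem lift_mem_of_mem_face {A : Type*} [NonUnitalRing A] [Module ℂ A] [IsScalarTower ℂ A A]
    [SMulCommClass ℂ A A] (c : X → Fin m) (F : Fin m → NonUnitalSubalgebra ℂ A) (a : X → A)
    (ha : ∀ x, a x ∈ F (c x)) (k : Fin m) (z : WordAlg X) (hz : z ∈ face c k) :
    lift a z ∈ F k := by
  have : face c k ≤ (F k).comap (lift a) := by
    refine NonUnitalAlgebra.adjoin_le ?_
    rintro _ ⟨x, rfl, rfl⟩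
    simpa using ha x
  exact this hz

theorem lift_ι_eq_ι (c : X → Fin m) (k : Fin m) (z : WordAlg X) (hz : z ∈ face c k) :
    lift (fun x => FreeProd.ι (A := fun k => face c k) (c x) ⟨letter x, letter_mem_face c x⟩) z =
      FreeProd.ι (A := fun k => face c k) k ⟨z, hz⟩ := by
  induction hz using NonUnitalAlgebra.adjoin_induction with
  | mem z hz => obtain ⟨x, rfl, rfl⟩ := hz; simp
  | add x y hx hy h1 h2 => rw [map_add, h1, h2, ← map_add]; rfl
  | zero =>
    rw [map_zero]
    exact (map_zero (FreeProd.ι (A := fun k => face c k) k)).symm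
  | mul x y hx hy h1 h2 => rw [map_mul, h1, h2, ← map_mul]; rfl
  | smul r x hx h1 => rw [map_smul, h1, ← map_smul]; rfl

end WordAlg

/-- The free algebra on a set of coloured letters, with the subalgebras generated by the letters
of the different colours as faces. -/
def FacedAlg.ofColours {m : ℕ} {X : Type u} (c : X → Fin m) : FacedAlg.{u} m where
  carrier := WordAlg X
  face := WordAlg.face c
  freelyGenerates := by
    refine bijective_of _ (WordAlg.lift fun x =>
      FreeProd.ι (A := fun k => WordAlg.face c k) (c x)
        ⟨WordAlg.letter x, WordAlg.letter_mem_face c x⟩) ?_ ?_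
    · rintro k ⟨z, hz⟩
      exact WordAlg.lift_ι_eq_ι c k z hz
    · refine WordAlg.hom_ext fun x => ?_
      simp only [NonUnitalAlgHom.comp_apply, WordAlg.lift_letter, FreeProd.lift_ι]
      rfl

/-! ## Universal products of words -/

theorem WordAlg.lift_scale {X : Type*} [DecidableEq X] (i : X) (r : ℂ) (v : FreeSemigroup X) :
    FreeSemigroup.lift (fun x => (if x = i then r else 1) • WordAlg.letter x) v =
      r ^ letterCount i v • WordAlg.word v := by
  induction v using FreeSemigroup.recOnMul with
  | ih1 x =>
    rw [letterCount_of]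
    by_cases h : x = i <;> simp [h, WordAlg.letter]
  | ih2 x v h1 h2 =>
    rw [map_mul, h1, h2, WordAlg.word_mul, letterCount_mul, smul_mul_smul_comm, pow_add]

namespace UAUProduct

variable {d m : ℕ} (P : UAUProduct.{u} d m) {X : Type u} (c : X → Fin m) (t : X → Bool)

/-- A letter in one of the two factors of a free product. -/
def tagged {A B : Type u}
    [NonUnitalRing A] [Module ℂ A] [IsScalarTower ℂ A A] [SMulCommClass ℂ A A]
    [NonUnitalRing B] [Module ℂ B] [IsScalarTower ℂ B B] [SMulCommClass ℂ B B]
    (a : X → A) (b : X → B) (x : X) : Coprod A B :=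
  if t x then Coprod.inr (b x) else Coprod.inl (a x)

/-- The value of the `l`-th component of `φ₁ ⊙ φ₂` on a word, in terms of the values of the
components of `φ₁` and `φ₂` on words; the tag of a letter says in which factor it lies. -/
def wordValue (l : Fin d) (w : FreeSemigroup X) (u : Bool → Fin d → FreeSemigroup X → ℂ) : ℂ :=
  P.prod (FacedAlg.ofColours c) (FacedAlg.ofColours c)
    (fun l => WordAlg.functional (u false l)) (fun l => WordAlg.functional (u true l)) l
    (FreeSemigroup.lift (tagged t WordAlg.letter WordAlg.letter) w :
      Coprod (WordAlg X) (WordAlg X))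

/-- Sending the letters to `a` and `b` defines homomorphisms from the free algebras that respect
faces, so universality pulls `φ₁ ⊙ φ₂` back to the free algebras. Hence only the values of `φ₁`,
`φ₂` on words in `a`, `b` enter. Every later identity for `wordValue` comes from applying this to a
suitable substitution. -/
theorem prod_word_eq (A B : FacedAlg.{u} m) (a : X → A) (b : X → B)
    (ha : ∀ x, a x ∈ A.face (c x)) (hb : ∀ x, b x ∈ B.face (c x))
    (φ : Bool → Fin d → FreeSemigroup X → ℂ)
    (φ₁ : DualTuple d A) (φ₂ : DualTuple d B)
    (h₁ : ∀ l v, φ₁ l (FreeSemigroup.lift a v) = φ false l v)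
    (h₂ : ∀ l v, φ₂ l (FreeSemigroup.lift b v) = φ true l v)
    (l : Fin d) (w : FreeSemigroup X) :
    P.prod A B φ₁ φ₂ l (FreeSemigroup.lift (tagged t a b) w : Coprod A B) =
      P.wordValue c t l w φ := by
  have key := P.universal A B (FacedAlg.ofColours c) (FacedAlg.ofColours c) (WordAlg.lift a)
    (WordAlg.lift b) (fun k z hz => WordAlg.lift_mem_of_mem_face c A.face a ha k z hz)
    (fun k z hz => WordAlg.lift_mem_of_mem_face c B.face b hb k z hz) φ₁ φ₂
  have e₁ : φ₁.comp (WordAlg.lift a) = fun l => WordAlg.functional (φ false l) :=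
    funext fun l => WordAlg.functional_ext fun v => by
      rw [WordAlg.functional_word, ← h₁]
      exact congrArg (φ₁ l) (WordAlg.lift_word a v)
  have e₂ : φ₂.comp (WordAlg.lift b) = fun l => WordAlg.functional (φ true l) :=
    funext fun l => WordAlg.functional_ext fun v => by
      rw [WordAlg.functional_word, ← h₂]
      exact congrArg (φ₂ l) (WordAlg.lift_word b v)
  have hw : FreeSemigroup.lift (tagged t a b) w =
      Coprod.map (WordAlg.lift a) (WordAlg.lift b)
        (FreeSemigroup.lift (tagged t WordAlg.letter WordAlg.letter) w) := by
    induction w using FreeSemigroup.recOnMul with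
    | ih1 x =>
      rw [FreeSemigroup.lift_of, FreeSemigroup.lift_of]
      by_cases h : t x <;> simp [tagged, h]
    | ih2 x v h1 h2 => rw [map_mul, map_mul, map_mul, h1, h2]
  rw [hw]
  unfold wordValue
  have := LinearMap.congr_fun (congrFun key l)
    (FreeSemigroup.lift (tagged t WordAlg.letter WordAlg.letter) w :
      Coprod (WordAlg X) (WordAlg X))
  refine Eq.trans ?_ (this.trans ?_)
  · rfl
  · exact congrArg₂ (fun p q => P.prod (FacedAlg.ofColours c) (FacedAlg.ofColours c) p q l
      (FreeSemigroup.lift (tagged t WordAlg.letter WordAlg.letter) w :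
      Coprod (WordAlg X) (WordAlg X))) e₁ e₂

variable [DecidableEq X]

/-- Substitute `r • i` for the letter `i`. The argument `w` contains `i` once and is multiplied by
`r`, whereas the value of a functional on `v` acquires a factor `r` for each occurrence of `i` in
`v`. -/
theorem wordValue_scale (l : Fin d) (w : FreeSemigroup X) (i : X) (hi : letterCount i w = 1)
    (u : Bool → Fin d → FreeSemigroup X → ℂ) (r : ℂ) :
    P.wordValue c t l w (fun s l v => r ^ letterCount i v * u s l v) =
      r * P.wordValue c t l w u := by
  let a : X → WordAlg X := fun x => (if x = i then r else 1) • WordAlg.letter x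
  have ha : ∀ x, a x ∈ WordAlg.face c (c x) := fun x =>
    SMulMemClass.smul_mem _ (WordAlg.letter_mem_face c x)
  have h : ∀ s l v, WordAlg.functional (u s l) (FreeSemigroup.lift a v) =
      r ^ letterCount i v * u s l v := fun s l v => by
    rw [WordAlg.lift_scale, map_smul, WordAlg.functional_word, smul_eq_mul]
  rw [← P.prod_word_eq c t (FacedAlg.ofColours c) (FacedAlg.ofColours c) a a ha ha
    (fun s l v => r ^ letterCount i v * u s l v)
    (fun l => WordAlg.functional (u false l)) (fun l => WordAlg.functional (u true l))
    (h false) (h true)]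
  obtain ⟨L, hL⟩ := exists_linear_of_letterCount_eq_one
    (tagged t WordAlg.letter WordAlg.letter : X → Coprod (WordAlg X) (WordAlg X)) i w hi
  have e₁ : (tagged t a a : X → Coprod (WordAlg X) (WordAlg X)) =
      Function.update (tagged t WordAlg.letter WordAlg.letter) i
        (r • tagged t WordAlg.letter WordAlg.letter i) := by
    funext x
    by_cases hx : x = i
    · subst hx; by_cases h : t x <;> simp [tagged, h, a]
    · by_cases h : t x <;> simp [tagged, h, a, hx]
  have e₂ := hL (tagged t WordAlg.letter WordAlg.letter i)
  rw [Function.update_eq_self] at e₂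
  have e₃ := (congrArg (fun g => FreeSemigroup.lift g w) e₁).trans (hL _)
  rw [map_smul, ← e₂] at e₃
  unfold wordValue
  refine (congrArg (P.prod (FacedAlg.ofColours c) (FacedAlg.ofColours c)
    (fun l => WordAlg.functional (u false l)) (fun l => WordAlg.functional (u true l)) l)
    e₃).trans ?_
  exact map_smul (P.prod (FacedAlg.ofColours c) (FacedAlg.ofColours c)
    (fun l => WordAlg.functional (u false l)) (fun l => WordAlg.functional (u true l)) l) r _

/-- The substitution `i ↦ γ i + δ ∗` with an additional letter `∗`. -/
def splitLetter (i : X) (γ δ : ℂ) (x : X) : WordAlg (Option X) :=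
  if x = i then γ • WordAlg.letter (some i) + δ • WordAlg.letter none else WordAlg.letter (some x)

/-- The substitution `i ↦ α i`, `∗ ↦ β i` which removes the additional letter `∗`. -/
def mergeLetter (i : X) (α β : ℂ) : Option X → WordAlg X
  | none => β • WordAlg.letter i
  | some x => (if x = i then α else 1) • WordAlg.letter x

theorem lift_mergeLetter_splitLetter (i : X) (α β γ δ : ℂ) (v : FreeSemigroup X) :
    WordAlg.lift (mergeLetter i α β) (FreeSemigroup.lift (splitLetter i γ δ) v) =
      (γ * α + δ * β) ^ letterCount i v • WordAlg.word v := by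
  rw [← WordAlg.lift_scale]
  induction v using FreeSemigroup.recOnMul with
  | ih1 x =>
    rw [FreeSemigroup.lift_of, FreeSemigroup.lift_of]
    by_cases hx : x = i
    · subst hx
      simp only [splitLetter, if_true, map_add, map_smul, WordAlg.lift_letter, mergeLetter,
        smul_smul, add_smul]
    · simp [splitLetter, hx, mergeLetter]
  | ih2 x v h1 h2 => rw [map_mul, map_mul, map_mul, h1, h2]

/-- Adjoin a letter `∗` of the colour of `i` and choose functionals `Ψ` on the larger free algebra
whose pullbacks along `i ↦ i`, `i ↦ ∗` and `i ↦ i + ∗` are `u`, `u'` and `u''`. Since `i` occurs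
once in `w`, the third substitution turns `w` into the sum of the results of the other two, and a
linear functional respects this sum. No relation between the three families is needed on words
containing `i` at least twice: there `Ψ` can be corrected on the mixed terms. -/
theorem wordValue_add (l : Fin d) (w : FreeSemigroup X) (i : X) (hi : letterCount i w = 1)
    (u u' u'' : Bool → Fin d → FreeSemigroup X → ℂ)
    (h0 : ∀ s l v, letterCount i v = 0 → u s l v = u'' s l v ∧ u' s l v = u'' s l v)
    (h1 : ∀ s l v, letterCount i v = 1 → u'' s l v = u s l v + u' s l v) :
    P.wordValue c t l w u'' = P.wordValue c t l w u + P.wordValue c t l w u' := by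
  let c' : Option X → Fin m := fun o => o.elim (c i) c
  -- The correction for words with `n ≥ 2` occurrences of `i`: under `i ↦ i + ∗` the last term of
  -- `Ψ` contributes `(2 ^ n - 2) * b`, and `2 ^ n - 2` is nonzero. It must vanish for `n = 0`,
  -- where the bracket in `Ψ` gives `-1`.
  let b : Bool → Fin d → FreeSemigroup X → ℂ := fun s l v =>
    if letterCount i v ≤ 1 then 0
    else (u'' s l v - u s l v - u' s l v) / (2 ^ letterCount i v - 2)
  let p : ℂ → ℂ → WordAlg (Option X) →ₗ[ℂ] WordAlg X := fun α β =>
    (WordAlg.lift (mergeLetter i α β) : WordAlg (Option X) →ₗ[ℂ] WordAlg X)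
  -- The term with `p 0 0` sees only words without `i` and `∗` and removes their double count. The
  -- bracket multiplying `b` vanishes for the substitutions `(1, 0)` and `(0, 1)` on words that
  -- contain `i`.
  let Ψ : Bool → DualTuple d (WordAlg (Option X)) := fun s l =>
    WordAlg.functional (u s l) ∘ₗ p 1 0 + WordAlg.functional (u' s l) ∘ₗ p 0 1 -
      WordAlg.functional (u s l) ∘ₗ p 0 0 +
      WordAlg.functional (b s l) ∘ₗ (p 1 1 - p 1 0 - p 0 1)
  have hp : ∀ (f : FreeSemigroup X → ℂ) α β γ δ v, WordAlg.functional f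
      (p α β (FreeSemigroup.lift (splitLetter i γ δ) v)) =
        (γ * α + δ * β) ^ letterCount i v * f v := fun f α β γ δ v => by
    refine (congrArg (WordAlg.functional f) (lift_mergeLetter_splitLetter i α β γ δ v)).trans ?_
    rw [map_smul, WordAlg.functional_word, smul_eq_mul]
  have hΨ : ∀ s l γ δ v, Ψ s l (FreeSemigroup.lift (splitLetter i γ δ) v) =
      γ ^ letterCount i v * u s l v + δ ^ letterCount i v * u' s l v -
        0 ^ letterCount i v * u s l v + ((γ + δ) ^ letterCount i v - γ ^ letterCount i v -
          δ ^ letterCount i v) * b s l v := fun s l γ δ v => by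
    simp only [Ψ, LinearMap.add_apply, LinearMap.sub_apply, LinearMap.comp_apply, map_sub, hp]
    simp only [mul_one, mul_zero, add_zero, zero_add]
    ring
  have hmem : ∀ γ δ x, splitLetter i γ δ x ∈ WordAlg.face c' (c x) := fun γ δ x => by
    unfold splitLetter
    split_ifs with hx
    · subst hx
      exact add_mem (SMulMemClass.smul_mem _ (WordAlg.letter_mem_face c' (some x)))
        (SMulMemClass.smul_mem _ (WordAlg.letter_mem_face c' none))
    · exact WordAlg.letter_mem_face c' (some x)
  have hval : ∀ γ δ (f : Bool → Fin d → FreeSemigroup X → ℂ),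
      (∀ s l v, Ψ s l (FreeSemigroup.lift (splitLetter i γ δ) v) = f s l v) →
      P.prod (FacedAlg.ofColours c') (FacedAlg.ofColours c') (Ψ false) (Ψ true) l
        (FreeSemigroup.lift (tagged t (splitLetter i γ δ) (splitLetter i γ δ)) w :
          Coprod (WordAlg (Option X)) (WordAlg (Option X))) = P.wordValue c t l w f :=
    fun γ δ f hf => P.prod_word_eq c t (FacedAlg.ofColours c') (FacedAlg.ofColours c') _ _
      (hmem γ δ) (hmem γ δ) f (Ψ false) (Ψ true) (hf false) (hf true) l w
  have hb : ∀ s l v, 2 ≤ letterCount i v →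
      (2 ^ letterCount i v - 2) * b s l v = u'' s l v - u s l v - u' s l v := fun s l v hv => by
    have : (2 ^ letterCount i v - 2 : ℂ) ≠ 0 := by
      have h : 2 ^ 2 ≤ 2 ^ letterCount i v := Nat.pow_le_pow_right (by norm_num) hv
      intro e
      have e' : ((2 ^ letterCount i v : ℕ) : ℂ) = (2 : ℕ) := by
        push_cast; exact sub_eq_zero.1 e
      have := Nat.cast_injective e'
      omega
    simp only [b, if_neg (not_le.2 (Nat.lt_of_succ_le hv))]
    field_simp
  have hb0 : ∀ s l v, letterCount i v ≤ 1 → b s l v = 0 := fun s l v hv => by simp [b, hv]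
  -- All three values become values of the one linear functional built from `Ψ`, so additivity is
  -- inherited from its arguments.
  rw [← hval 1 0 u ?_, ← hval 0 1 u' ?_, ← hval 1 1 u'' ?_]
  · obtain ⟨L, hL⟩ := exists_linear_of_letterCount_eq_one
      (tagged t (WordAlg.letter ∘ some) (WordAlg.letter ∘ some) :
        X → Coprod (WordAlg (Option X)) (WordAlg (Option X))) i w hi
    let y₁ : Coprod (WordAlg (Option X)) (WordAlg (Option X)) :=
      tagged t (WordAlg.letter ∘ some) (WordAlg.letter ∘ some) i
    let y₂ : Coprod (WordAlg (Option X)) (WordAlg (Option X)) :=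
      tagged t (fun _ => WordAlg.letter none) (fun _ => WordAlg.letter none) i
    have e : ∀ γ δ, FreeSemigroup.lift (tagged t (splitLetter i γ δ) (splitLetter i γ δ)) w =
        L (γ • y₁ + δ • y₂) := fun γ δ => by
      rw [← hL]
      congr 2
      funext x
      by_cases hx : x = i
      · subst hx; by_cases h : t x <;> simp [tagged, h, splitLetter, y₁, y₂]
      · by_cases h : t x <;> simp [tagged, h, splitLetter, hx]
    have e' : FreeSemigroup.lift (tagged t (splitLetter i 1 1) (splitLetter i 1 1)) w =
        FreeSemigroup.lift (tagged t (splitLetter i 1 0) (splitLetter i 1 0)) w +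
        FreeSemigroup.lift (tagged t (splitLetter i 0 1) (splitLetter i 0 1)) w := by
      rw [e, e, e, ← map_add]; simp
    exact (congrArg (P.prod (FacedAlg.ofColours c') (FacedAlg.ofColours c') (Ψ false) (Ψ true) l)
      e').trans (map_add (P.prod (FacedAlg.ofColours c') (FacedAlg.ofColours c') (Ψ false)
        (Ψ true) l) _ _)
  all_goals
    intro s l v
    rw [hΨ]
    rcases Nat.lt_trichotomy (letterCount i v) 1 with h | h | h
    · have h' : letterCount i v = 0 := by omega
      rw [hb0 s l v (by omega), h', (h0 s l v h').1, (h0 s l v h').2]; simp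
    · rw [hb0 s l v (by omega), h]; simp [h1 s l v h]
    · have h' : letterCount i v ≠ 0 := by omega
      have := hb s l v h
      simp [h', one_add_one_eq_two]
      try linear_combination this

end UAUProduct

/-! ### Polynomial dependence for multilinear words -/

namespace UAUProduct

variable {d m : ℕ} (P : UAUProduct.{u} d m) {X : Type u} [DecidableEq X]
  (c : X → Fin m) (t : X → Bool)

/-- Let `z` be `u` cut down to the words without `i`. Additivity leaves the sum unconstrained on
words with at least two `i`, so both `u` and `u'` are admissible sums of `u` and `z`. -/
theorem wordValue_eq_of_letterCount_le_one (l : Fin d) {w : FreeSemigroup X}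
    (hw : ∀ x, letterCount x w = 1)
    (i : X) (u u' : Bool → Fin d → FreeSemigroup X → ℂ)
    (h : ∀ s l v, letterCount i v ≤ 1 → u s l v = u' s l v) :
    P.wordValue c t l w u = P.wordValue c t l w u' := by
  let z : Bool → Fin d → FreeSemigroup X → ℂ := fun s l v =>
    if letterCount i v = 0 then u s l v else 0
  have h₁ := P.wordValue_add c t l w i (hw i) u z u'
    (fun s l v hv => by simp [z, hv, h s l v (by omega)])
    (fun s l v hv => by simp [z, hv, h s l v (by omega)])
  have h₂ := P.wordValue_add c t l w i (hw i) u z u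
    (fun s l v hv => by simp [z, hv]) (fun s l v hv => by simp [z, hv])
  rw [h₁, ← h₂]

/-- The values on words with repeated letters do not matter. -/
theorem wordValue_congr (l : Fin d) {w : FreeSemigroup X}
    (hw : ∀ x, letterCount x w = 1)
    [Finite X] (u u' : Bool → Fin d → FreeSemigroup X → ℂ)
    (h : ∀ s l v, (∀ x, letterCount x v ≤ 1) → u s l v = u' s l v) :
    P.wordValue c t l w u = P.wordValue c t l w u' := by
  have := Fintype.ofFinite X
  suffices key : ∀ (S : Finset X) (u u' : Bool → Fin d → FreeSemigroup X → ℂ),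
      (∀ s l v, (∀ x ∈ S, letterCount x v ≤ 1) → u s l v = u' s l v) →
      P.wordValue c t l w u = P.wordValue c t l w u' from
    key Finset.univ u u' fun s l v hv => h s l v fun x => hv x (Finset.mem_univ x)
  intro S
  induction S using Finset.induction_on with
  | empty =>
    intro u u' h
    congr
    funext s l v
    exact h s l v (by simp)
  | insert i S _ ih =>
    intro u u' h
    -- Deal with one letter at a time: pass from `u` to `u'` on the words that repeat `i`, then use
    -- the induction hypothesis for the remaining letters.
    let u₁ : Bool → Fin d → FreeSemigroup X → ℂ := fun s l v =>
      if letterCount i v ≤ 1 then u s l v else u' s l v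
    refine (P.wordValue_eq_of_letterCount_le_one c t l hw i u u₁
      fun s l v hv => by simp [u₁, hv]).trans (ih u₁ u' fun s l v hv => ?_)
    by_cases hi : letterCount i v ≤ 1
    · simp only [u₁, if_pos hi]
      refine h s l v fun x hx => ?_
      rcases Finset.mem_insert.1 hx with rfl | hx
      exacts [hi, hv x hx]
    · simp [u₁, hi]

/-- The value on a word is an affine function of each of the variables. -/
theorem wordValue_affine (l : Fin d) {w : FreeSemigroup X}
    (hw : ∀ x, letterCount x w = 1)
    (u : Bool → Fin d → FreeSemigroup X → ℂ)
    (j : Bool × Fin d × FreeSemigroup X) (r : ℂ) :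
    P.wordValue c t l w (fun s l v => if (s, l, v) = j then r else u s l v) =
      P.wordValue c t l w (fun s l v => if (s, l, v) = j then 0 else u s l v) +
      r * (P.wordValue c t l w (fun s l v => if (s, l, v) = j then 1 else u s l v) -
        P.wordValue c t l w (fun s l v => if (s, l, v) = j then 0 else u s l v)) := by
  -- Any letter of the word of the variable `j` will do. Additivity in `i` splits off the
  -- contribution `z r` of this variable, where the values on words without `i` are kept, as
  -- additivity requires.
  obtain ⟨i, hi⟩ := exists_letterCount_pos j.2.2
  let z : ℂ → Bool → Fin d → FreeSemigroup X → ℂ := fun r s l v =>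
    if (s, l, v) = j then r else if letterCount i v = 0 then u s l v else 0
  have hj : ∀ {s l v}, (s, l, v) = j → letterCount i v = letterCount i j.2.2 := by
    rintro s l v rfl; rfl
  have hz : ∀ r, P.wordValue c t l w (fun s l v => if (s, l, v) = j then r else u s l v) =
      P.wordValue c t l w (fun s l v => if (s, l, v) = j then 0 else u s l v) +
        P.wordValue c t l w (z r) := fun r => by
    refine P.wordValue_add c t l w i (hw i) _ _ _ (fun s l v hv => ?_) (fun s l v hv => ?_)
    · have : (s, l, v) ≠ j := fun e => by have := hj e; omega
      simp [z, this, hv]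
    · by_cases e : (s, l, v) = j <;> simp [z, e, hv]
  have hscale : ∀ r, P.wordValue c t l w (z r) = r * P.wordValue c t l w (z 1) := by
    by_cases h1 : letterCount i j.2.2 = 1
    · intro r
      rw [← P.wordValue_scale c t l w i (hw i)]
      congr
      funext s l v
      by_cases e : (s, l, v) = j
      · simp only [z, if_pos e, hj e, h1]; ring
      · by_cases h0 : letterCount i v = 0 <;> simp [z, e, h0]
    -- If `i` is repeated in the word of `j`, then `j` does not matter, and apart from it `z r`
    -- lives on words without `i`. Scaling `i` by `0` therefore changes nothing relevant, yet
    -- multiplies the value by `0`.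
    · have h0 : ∀ r, P.wordValue c t l w (z r) = 0 := fun r => by
        rw [← zero_mul (P.wordValue c t l w (z r)), ← P.wordValue_scale c t l w i (hw i)]
        refine P.wordValue_eq_of_letterCount_le_one c t l hw i _ _ fun s l v hv => ?_
        have e : (s, l, v) ≠ j := fun e => by have := hj e; omega
        by_cases h0 : letterCount i v = 0 <;> simp [z, e, h0]
      intro r
      rw [h0, h0, mul_zero]
  rw [hz r, hz 1, hscale r]
  ring

/-- A function that is affine in each of finitely many variables is a polynomial in them: each new
variable enters as `F₀ + U * (F₁ - F₀)`, with `F₀`, `F₁` covered by induction because the frozen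
values `a` are arbitrary. -/
theorem wordValue_mem_of_finset (l : Fin d) {w : FreeSemigroup X}
    (hw : ∀ x, letterCount x w = 1)
    {Φ : Type*} (R : Subalgebra ℂ (Φ → ℂ))
    (U : Bool → Fin d → FreeSemigroup X → Φ → ℂ) (hU : ∀ s l v, U s l v ∈ R)
    (S : Finset (Bool × Fin d × FreeSemigroup X)) (a : Bool → Fin d → FreeSemigroup X → ℂ) :
    (fun φ => P.wordValue c t l w (fun s l v => if (s, l, v) ∈ S then U s l v φ else a s l v)) ∈
      R := by
  induction S using Finset.induction_on generalizing a with
  | empty =>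
    simp only [Finset.notMem_empty, if_false]
    exact R.algebraMap_mem (P.wordValue c t l w a)
  | insert j S hj ih =>
    have h : ∀ r φ, (fun s l v => if (s, l, v) = j then r else
          if (s, l, v) ∈ S then U s l v φ else a s l v) =
        fun s l v => if (s, l, v) ∈ S then U s l v φ else
          if (s, l, v) = j then r else a s l v := fun r φ => by
      funext s l v
      by_cases e : (s, l, v) = j
      · simp [e, hj]
      · simp [e]
    have h' : ∀ φ, (fun s l v => if (s, l, v) ∈ insert j S then U s l v φ else a s l v) =
        fun s l v => if (s, l, v) = j then U j.1 j.2.1 j.2.2 φ else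
          if (s, l, v) ∈ S then U s l v φ else a s l v := fun φ => by
      funext s l v
      by_cases e : (s, l, v) = j
      · subst e; simp
      · simp [e]
    have hF : (fun φ => P.wordValue c t l w
        (fun s l v => if (s, l, v) ∈ insert j S then U s l v φ else a s l v)) =
        (fun φ => P.wordValue c t l w (fun s l v => if (s, l, v) ∈ S then U s l v φ else
          if (s, l, v) = j then 0 else a s l v)) +
        U j.1 j.2.1 j.2.2 *
        ((fun φ => P.wordValue c t l w (fun s l v => if (s, l, v) ∈ S then U s l v φ else
          if (s, l, v) = j then 1 else a s l v)) -
        (fun φ => P.wordValue c t l w (fun s l v => if (s, l, v) ∈ S then U s l v φ else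
          if (s, l, v) = j then 0 else a s l v))) := by
      funext φ
      simp only [Pi.add_apply, Pi.mul_apply, Pi.sub_apply, ← h]
      rw [h', P.wordValue_affine c t l hw]
    rw [hF]
    exact R.add_mem (ih _) (R.mul_mem (hU _ _ _) (R.sub_mem (ih _) (ih _)))

/-- The value on a multilinear word is a polynomial in the variables. -/
theorem wordValue_mem (l : Fin d) {w : FreeSemigroup X}
    (hw : ∀ x, letterCount x w = 1)
    [Finite X] {Φ : Type*} (R : Subalgebra ℂ (Φ → ℂ))
    (U : Bool → Fin d → FreeSemigroup X → Φ → ℂ) (hU : ∀ s l v, U s l v ∈ R) :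
    (fun φ => P.wordValue c t l w (fun s l v => U s l v φ)) ∈ R := by
  -- Only variables without repeated letters matter, and over a finite alphabet there are finitely
  -- many; the others are frozen at `0`.
  have hf : {j : Bool × Fin d × FreeSemigroup X | ∀ x, letterCount x j.2.2 ≤ 1}.Finite :=
    (Set.finite_univ.prod (Set.finite_univ.prod finite_letterCount_le_one)).subset
      fun j hj => ⟨trivial, trivial, hj⟩
  convert P.wordValue_mem_of_finset c t l hw R U hU hf.toFinset (fun _ _ _ => 0) using 2 with φ
  refine P.wordValue_congr c t l hw _ _ fun s l v hv => ?_
  rw [if_pos]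
  simpa using hv

end UAUProduct

/-! ## Generation -/

theorem FreeProd.mem_of_ι_mem {I : Type} [DecidableEq I] {A : I → Type u}
    [∀ i, NonUnitalRing (A i)] [∀ i, Module ℂ (A i)] [∀ i, IsScalarTower ℂ (A i) (A i)]
    [∀ i, SMulCommClass ℂ (A i) (A i)] (N : NonUnitalSubalgebra ℂ (FreeProd A))
    (h : ∀ i a, FreeProd.ι i a ∈ N) (x : FreeProd A) : x ∈ N := by
  obtain ⟨x, hx⟩ := x
  induction hx using NonUnitalAlgebra.adjoin_induction with
  | mem x hx => obtain ⟨i, a, rfl⟩ := hx; exact h i a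
  | add x y hx hy h1 h2 => exact N.add_mem h1 h2
  | zero => exact N.zero_mem
  | mul x y hx hy h1 h2 => exact N.mul_mem h1 h2
  | smul r x hx h1 => exact N.smul_mem r h1

theorem Coprod.mem_of_mem {A B : Type u}
    [NonUnitalRing A] [Module ℂ A] [IsScalarTower ℂ A A] [SMulCommClass ℂ A A]
    [NonUnitalRing B] [Module ℂ B] [IsScalarTower ℂ B B] [SMulCommClass ℂ B B]
    (N : NonUnitalSubalgebra ℂ (Coprod A B)) (h₁ : ∀ a, Coprod.inl a ∈ N)
    (h₂ : ∀ b, Coprod.inr b ∈ N) (x : Coprod A B) : x ∈ N :=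
  FreeProd.mem_of_ι_mem (A := PairFam A B) N (fun i => match i with
    | false => h₁
    | true => h₂) x

theorem FacedAlg.mem_of_face_mem {m : ℕ} (A : FacedAlg.{u} m) (N : NonUnitalSubalgebra ℂ A)
    (h : ∀ k, ∀ a ∈ A.face k, a ∈ N) (x : A) : x ∈ N := by
  obtain ⟨y, rfl⟩ := A.freelyGenerates.2 x
  exact FreeProd.mem_of_ι_mem
    (N.comap (FreeProd.lift fun k => NonUnitalSubalgebraClass.subtype (A.face k)))
    (fun k a => by
      rw [NonUnitalSubalgebra.mem_comap, FreeProd.lift_ι]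
      exact h k a a.2) y

/-! ### The product as a polynomial function of the two tuples -/

namespace UAUProduct

variable {d m : ℕ} (P : UAUProduct.{u} d m) (A B : FacedAlg.{u} m)

/-- The elements of `S(A^d) ⊗ S(B^d)` as polynomial functions of a pair of tuples of
functionals. -/
def evalPair (d : ℕ) (A B : FacedAlg.{u} m) :
    SymmetricAlgebra ℂ (Fin d → A) ⊗[ℂ] SymmetricAlgebra ℂ (Fin d → B) →ₐ[ℂ]
      (DualTuple d A × DualTuple d B → ℂ) :=
  AlgHom.pi fun φ => (Algebra.TensorProduct.lmul' ℂ).comp (Algebra.TensorProduct.map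
    (SymmetricAlgebra.lift φ.1.total) (SymmetricAlgebra.lift φ.2.total))

theorem _root_.DualTuple.total_single {W : Type*} [AddCommGroup W] [Module ℂ W]
    (φ : DualTuple d W) (l : Fin d) (a : W) : φ.total (Pi.single l a) = φ l a := by
  unfold DualTuple.total
  rw [LinearMap.sum_apply, Finset.sum_eq_single l]
  · simp
  · intro k _ hk; simp [hk]
  · simp

theorem fst_mem_range_evalPair (l : Fin d) (a : A) :
    (fun φ : DualTuple d A × DualTuple d B => φ.1 l a) ∈ (evalPair d A B).range :=
  ⟨SymmetricAlgebra.ι ℂ _ (Pi.single l a) ⊗ₜ 1, by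
    funext φ
    simp [evalPair, DualTuple.total_single]⟩

theorem snd_mem_range_evalPair (l : Fin d) (b : B) :
    (fun φ : DualTuple d A × DualTuple d B => φ.2 l b) ∈ (evalPair d A B).range :=
  ⟨1 ⊗ₜ SymmetricAlgebra.ι ℂ _ (Pi.single l b), by
    funext φ
    simp [evalPair, DualTuple.total_single]⟩

/-- The components of `φ₁ ⊙ φ₂` on a fixed element are polynomial functions of `φ₁`, `φ₂`. -/
theorem prod_mem_range_evalPair (l : Fin d) (x : Coprod A B) :
    (fun φ : DualTuple d A × DualTuple d B => P.prod A B φ.1 φ.2 l x) ∈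
      (evalPair d A B).range := by
  classical
  -- Elements of the faces serve as letters, so that each letter has a colour; words in them span
  -- the free product, as the faces generate.
  let Y : Type u := (Σ k, A.face k) ⊕ (Σ k, B.face k)
  let y : Y → Coprod A B := Sum.elim (fun a => Coprod.inl (a.2 : A)) fun b => Coprod.inr (b.2 : B)
  have hsurj : x ∈ NonUnitalAlgHom.range (WordAlg.lift y) := by
    refine Coprod.mem_of_mem _ (fun a => ?_) (fun b => ?_) x
    · refine A.mem_of_face_mem
        ((NonUnitalAlgHom.range (WordAlg.lift y)).comap (Coprod.inl : A →ₙₐ[ℂ] Coprod A B))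
        (fun k a ha => ⟨WordAlg.letter (Sum.inl ⟨k, a, ha⟩), ?_⟩) a
      exact WordAlg.lift_letter y _
    · refine B.mem_of_face_mem
        ((NonUnitalAlgHom.range (WordAlg.lift y)).comap (Coprod.inr : B →ₙₐ[ℂ] Coprod A B))
        (fun k b hb => ⟨WordAlg.letter (Sum.inr ⟨k, b, hb⟩), ?_⟩) b
      exact WordAlg.lift_letter y _
  obtain ⟨q, rfl⟩ := hsurj
  let N : Submodule ℂ (WordAlg Y) := (Subalgebra.toSubmodule (evalPair d A B).range).comap
    (LinearMap.pi fun φ : DualTuple d A × DualTuple d B =>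
      (show Coprod A B →ₗ[ℂ] ℂ from P.prod A B φ.1 φ.2 l) ∘ₗ
        (WordAlg.lift y : WordAlg Y →ₗ[ℂ] Coprod A B))
  have hN : N = ⊤ := by
    rw [eq_top_iff, ← (MonoidAlgebra.basis (FreeSemigroup Y) ℂ).span_eq, Submodule.span_le]
    rintro _ ⟨w, rfl⟩
    rw [WordAlg.basis_apply]
    change (fun φ : DualTuple d A × DualTuple d B =>
        P.prod A B φ.1 φ.2 l (WordAlg.lift y (WordAlg.word w))) ∈ (evalPair d A B).range
    obtain ⟨X, _, _, g, v, hv, rfl⟩ := exists_multilinear_word w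
    let c : X → Fin m := fun x => Sum.elim (fun a => a.1) (fun b => b.1) (g x)
    let t : X → Bool := fun x => (g x).isRight
    -- Letters tagged for the other factor need some value in the face of their colour; `0` lies in
    -- every face, and `tagged` never uses it.
    let a : X → A := fun x => Sum.elim (fun a => (a.2 : A)) (fun _ => 0) (g x)
    let b : X → B := fun x => Sum.elim (fun _ => 0) (fun b => (b.2 : B)) (g x)
    have ha : ∀ x, a x ∈ A.face (c x) := fun x => by
      simp only [a, c]
      rcases g x with p | p
      · exact p.2.2
      · exact zero_mem _
    have hb : ∀ x, b x ∈ B.face (c x) := fun x => by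
      simp only [b, c]
      rcases g x with p | p
      · exact zero_mem _
      · exact p.2.2
    have hword : WordAlg.lift y (WordAlg.word (FreeSemigroup.map g v)) =
        FreeSemigroup.lift (tagged t a b) v := by
      rw [WordAlg.lift_word]
      clear hv
      induction v using FreeSemigroup.recOnMul with
      | ih1 x =>
        simp only [FreeSemigroup.map_of, FreeSemigroup.lift_of, y, tagged, t, a, b]
        rcases g x with p | p <;> simp
      | ih2 x v h1 h2 => rw [map_mul, map_mul, map_mul, h1, h2]
    rw [hword]
    let U : Bool → Fin d → FreeSemigroup X → DualTuple d A × DualTuple d B → ℂ := fun s l v φ =>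
      bif s then φ.2 l (FreeSemigroup.lift b v) else φ.1 l (FreeSemigroup.lift a v)
    convert P.wordValue_mem c t l hv (evalPair d A B).range U ?_ using 2 with φ
    · exact P.prod_word_eq c t A B a b ha hb (fun s l v => U s l v φ) φ.1 φ.2 (fun _ _ => rfl)
        (fun _ _ => rfl) l v
    · rintro (_ | _) l v
      · exact fst_mem_range_evalPair A B l _
      · exact snd_mem_range_evalPair A B l _
  exact (hN ▸ Submodule.mem_top : q ∈ N)

end UAUProduct

/-! ## Separating families of characters -/

section Separating

/-- A family of characters is separating if only `0` is annihilated by all of them. -/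
def IsSeparating {ι B : Type*} [CommRing B] [Algebra ℂ B] (F : ι → B →ₐ[ℂ] ℂ) : Prop :=
  ∀ x, (∀ i, F i x = 0) → x = 0

/-- This reduces identities between comultiplications to identities between tuples of functionals.
-/
theorem IsSeparating.hom_ext {ι B C : Type*} [CommRing B] [Algebra ℂ B] [CommRing C] [Algebra ℂ C]
    {F : ι → B →ₐ[ℂ] ℂ} (hF : IsSeparating F) {f g : C →ₐ[ℂ] B}
    (h : ∀ i, (F i).comp f = (F i).comp g) : f = g := by
  ext x
  refine sub_eq_zero.1 (hF _ fun i => ?_)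
  rw [map_sub, sub_eq_zero]
  exact DFunLike.congr_fun (h i) x

/-- A basis of `W` identifies `S(W)` with polynomials and these characters with evaluations at
points; over an infinite field a polynomial vanishing everywhere is zero. -/
theorem isSeparating_symmetricAlgebra_lift (W : Type*) [AddCommGroup W] [Module ℂ W] :
    IsSeparating fun f : W →ₗ[ℂ] ℂ => SymmetricAlgebra.lift f := by
  intro x hx
  let b := Module.Basis.ofVectorSpace ℂ W
  let e := SymmetricAlgebra.equivMvPolynomial b
  have key : ∀ p : Module.Basis.ofVectorSpaceIndex ℂ W → ℂ,
      (MvPolynomial.aeval p).comp (e : SymmetricAlgebra ℂ W →ₐ[ℂ] _) =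
        SymmetricAlgebra.lift (b.constr ℂ p) := fun p => by
    refine SymmetricAlgebra.algHom_ext (b.ext fun i => ?_)
    simp [e]
  have h : e x = 0 := MvPolynomial.funext fun p => by
    have := DFunLike.congr_fun (key p) x
    rw [hx] at this
    simpa [MvPolynomial.aeval_eq_eval] using this
  exact (map_eq_zero_iff e e.injective).1 h

variable {ι κ B C : Type*} [CommRing B] [Algebra ℂ B] [CommRing C] [Algebra ℂ C]

/-- The character of `B ⊗ C` given by a pair of characters. -/
def tensorChar (f : B →ₐ[ℂ] ℂ) (g : C →ₐ[ℂ] ℂ) : B ⊗[ℂ] C →ₐ[ℂ] ℂ :=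
  (Algebra.TensorProduct.lmul' ℂ).comp (Algebra.TensorProduct.map f g)

@[simp]
theorem tensorChar_tmul (f : B →ₐ[ℂ] ℂ) (g : C →ₐ[ℂ] ℂ) (b : B) (c : C) :
    tensorChar f g (b ⊗ₜ c) = f b * g c := by
  simp [tensorChar]

/-- Expand the tensor along a basis of `C`. Applying `F i` to its coefficients gives an element of
`C` killed by all `G j`, hence zero; linear independence shows that `F i` kills each coefficient,
for every `i`. -/
theorem IsSeparating.tensor {F : ι → B →ₐ[ℂ] ℂ} {G : κ → C →ₐ[ℂ] ℂ} (hF : IsSeparating F)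
    (hG : IsSeparating G) : IsSeparating fun p : ι × κ => tensorChar (F p.1) (G p.2) := by
  classical
  intro t ht
  let b := Module.Basis.ofVectorSpace ℂ C
  let e := TensorProduct.equivFinsuppOfBasisRight (M := B) b
  have h₁ : ∀ i, ∑ k ∈ (e t).support, F i (e t k) • b k = 0 := fun i => by
    refine hG _ fun j => ?_
    have h := ht (i, j)
    rw [← e.symm_apply_apply t, TensorProduct.equivFinsuppOfBasisRight_symm_apply,
      Finsupp.sum, map_sum] at h
    simpa [map_sum] using h
  have h₂ : e t = 0 := by
    ext k
    refine hF _ fun i => ?_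
    by_cases hk : k ∈ (e t).support
    · exact linearIndependent_iff'.1 b.linearIndependent _ _ (h₁ i) k hk
    · rw [Finsupp.notMem_support_iff.1 hk, map_zero]
  exact (map_eq_zero_iff e e.injective).1 h₂

end Separating

/-! ### Tuples of functionals as characters -/

namespace DualTuple

variable {d : ℕ}

theorem total_apply {W : Type*} [AddCommGroup W] [Module ℂ W] (φ : DualTuple d W)
    (x : Fin d → W) : φ.total x = ∑ l, φ l (x l) := by
  simp [total]

theorem exists_total_eq {W : Type*} [AddCommGroup W] [Module ℂ W] (f : (Fin d → W) →ₗ[ℂ] ℂ) :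
    ∃ φ : DualTuple d W, φ.total = f := by
  refine ⟨fun l => f ∘ₗ LinearMap.single ℂ (fun _ => W) l, LinearMap.ext fun x => ?_⟩
  rw [total_apply]
  simp only [LinearMap.comp_apply, LinearMap.single_apply]
  rw [← map_sum, Finset.univ_sum_single]

theorem total_zero {W : Type*} [AddCommGroup W] [Module ℂ W] :
    (0 : DualTuple d W).total = 0 := by
  ext; simp [total_apply]

theorem total_comp {A B : Type*} [NonUnitalRing A] [Module ℂ A] [NonUnitalRing B] [Module ℂ B]
    (φ : DualTuple d A) (j : B →ₙₐ[ℂ] A) :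
    (φ.comp j).total = φ.total ∘ₗ (j : B →ₗ[ℂ] A).compLeft (Fin d) := by
  refine LinearMap.ext fun x => ?_
  rw [LinearMap.comp_apply, total_apply, total_apply]
  rfl

/-- The character `S(φ)` of `S(W^d)`. -/
def char {W : Type*} [AddCommGroup W] [Module ℂ W] (φ : DualTuple d W) :
    SymmetricAlgebra ℂ (Fin d → W) →ₐ[ℂ] ℂ := SymmetricAlgebra.lift φ.total

theorem isSeparating_char (W : Type*) [AddCommGroup W] [Module ℂ W] :
    IsSeparating fun φ : DualTuple d W => φ.char := by
  intro x hx
  refine isSeparating_symmetricAlgebra_lift _ x fun f => ?_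
  obtain ⟨φ, rfl⟩ := exists_total_eq f
  exact hx φ

end DualTuple

/-! ### Existence and uniqueness of `σ` -/

namespace UAUProduct

variable {d m : ℕ} (P : UAUProduct.{u} d m) (A B : FacedAlg.{u} m)

theorem isSigma_iff (σ : (Fin d → A.prod B) →ₗ[ℂ]
    SymmetricAlgebra ℂ (Fin d → A) ⊗[ℂ] SymmetricAlgebra ℂ (Fin d → B)) :
    P.IsSigma A B σ ↔ ∀ φ₁ φ₂ x,
      tensorChar (DualTuple.char φ₁) (DualTuple.char φ₂) (σ x) = (P.prod A B φ₁ φ₂).total x :=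
  ⟨fun h φ₁ φ₂ x => (h φ₁ φ₂ x).symm, fun h φ₁ φ₂ x => (h φ₁ φ₂ x).symm⟩

/-- Separation by characters makes `evalPair` injective, and the polynomiality of the product puts
`x ↦ ((φ₁, φ₂) ↦ (φ₁ ⊙ φ₂) x)` into its range; `σ` is this map followed by the inverse of
`evalPair`. -/
theorem existsUnique_isSigma : ∃! σ, P.IsSigma A B σ := by
  have hE : Function.Injective (evalPair d A B) := by
    rw [injective_iff_map_eq_zero]
    intro t ht
    exact (DualTuple.isSeparating_char (d := d) A).tensor (DualTuple.isSeparating_char (d := d) B)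
      t fun φ => congrFun ht φ
  let G : (Fin d → A.prod B) →ₗ[ℂ] (DualTuple d A × DualTuple d B → ℂ) :=
    LinearMap.pi fun φ => (P.prod A B φ.1 φ.2).total
  have hG : ∀ x, G x ∈ LinearMap.range (evalPair d A B).toLinearMap := fun x => by
    have e : G x = ∑ l, fun φ : DualTuple d A × DualTuple d B => P.prod A B φ.1 φ.2 l (x l) := by
      funext φ
      simp [G, DualTuple.total_apply]
    rw [e]
    exact sum_mem fun l _ => P.prod_mem_range_evalPair A B l (x l)
  let e := LinearEquiv.ofInjective (evalPair d A B).toLinearMap hE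
  have he : ∀ y, evalPair d A B (e.symm y) = y.1 := fun y =>
    congrArg Subtype.val (e.apply_symm_apply y)
  refine ⟨e.symm.toLinearMap ∘ₗ G.codRestrict _ hG, fun φ₁ φ₂ x => ?_, fun σ hσ => ?_⟩
  · exact (congrFun (he ⟨G x, hG x⟩) (φ₁, φ₂)).symm
  · refine LinearMap.ext fun x => hE ?_
    refine Eq.trans ?_ (he ⟨G x, hG x⟩).symm
    funext φ
    exact (hσ φ.1 φ.2 x).symm

theorem isSigma_sigma : P.IsSigma A B (P.sigma A B) := by
  have h := (P.existsUnique_isSigma A B).exists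
  rw [sigma, dif_pos h]
  exact h.choose_spec

theorem tensorChar_sigma (φ₁ : DualTuple d A) (φ₂ : DualTuple d B) (x : Fin d → A.prod B) :
    tensorChar φ₁.char φ₂.char (P.sigma A B x) = (P.prod A B φ₁ φ₂).total x :=
  (P.isSigma_iff A B _).1 (P.isSigma_sigma A B) φ₁ φ₂ x

end UAUProduct

/-! ## The comultiplication on the powers of a dual semigroup -/

theorem Coprod.map_map {A B A' B' A'' B'' : Type u}
    [NonUnitalRing A] [Module ℂ A] [IsScalarTower ℂ A A] [SMulCommClass ℂ A A]
    [NonUnitalRing B] [Module ℂ B] [IsScalarTower ℂ B B] [SMulCommClass ℂ B B]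
    [NonUnitalRing A'] [Module ℂ A'] [IsScalarTower ℂ A' A'] [SMulCommClass ℂ A' A']
    [NonUnitalRing B'] [Module ℂ B'] [IsScalarTower ℂ B' B'] [SMulCommClass ℂ B' B']
    [NonUnitalRing A''] [Module ℂ A''] [IsScalarTower ℂ A'' A''] [SMulCommClass ℂ A'' A'']
    [NonUnitalRing B''] [Module ℂ B''] [IsScalarTower ℂ B'' B''] [SMulCommClass ℂ B'' B'']
    (j₁ : A →ₙₐ[ℂ] A') (j₂ : B →ₙₐ[ℂ] B') (k₁ : A' →ₙₐ[ℂ] A'') (k₂ : B' →ₙₐ[ℂ] B'')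
    (x : Coprod A B) :
    Coprod.map k₁ k₂ (Coprod.map j₁ j₂ x) = Coprod.map (k₁.comp j₁) (k₂.comp j₂) x := by
  have : (Coprod.map k₁ k₂).comp (Coprod.map j₁ j₂) = Coprod.map (k₁.comp j₁) (k₂.comp j₂) :=
    Coprod.hom_ext (fun a => by simp) (fun b => by simp)
  exact DFunLike.congr_fun this x

theorem Coprod.map_mem {A B A' B' : Type u}
    [NonUnitalRing A] [Module ℂ A] [IsScalarTower ℂ A A] [SMulCommClass ℂ A A]
    [NonUnitalRing B] [Module ℂ B] [IsScalarTower ℂ B B] [SMulCommClass ℂ B B]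
    [NonUnitalRing A'] [Module ℂ A'] [IsScalarTower ℂ A' A'] [SMulCommClass ℂ A' A']
    [NonUnitalRing B'] [Module ℂ B'] [IsScalarTower ℂ B' B'] [SMulCommClass ℂ B' B']
    (N : NonUnitalSubalgebra ℂ (Coprod A' B')) (j₁ : A →ₙₐ[ℂ] A') (j₂ : B →ₙₐ[ℂ] B')
    (h₁ : ∀ a, Coprod.inl (j₁ a) ∈ N) (h₂ : ∀ b, Coprod.inr (j₂ b) ∈ N) (x : Coprod A B) :
    Coprod.map j₁ j₂ x ∈ N :=
  Coprod.mem_of_mem (N.comap (Coprod.map j₁ j₂))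
    (fun a => by rw [NonUnitalSubalgebra.mem_comap, Coprod.map_inl]; exact h₁ a)
    (fun b => by rw [NonUnitalSubalgebra.mem_comap, Coprod.map_inr]; exact h₂ b) x

theorem Coprod.assoc_map {A B C A' B' C' : Type u}
    [NonUnitalRing A] [Module ℂ A] [IsScalarTower ℂ A A] [SMulCommClass ℂ A A]
    [NonUnitalRing B] [Module ℂ B] [IsScalarTower ℂ B B] [SMulCommClass ℂ B B]
    [NonUnitalRing C] [Module ℂ C] [IsScalarTower ℂ C C] [SMulCommClass ℂ C C]
    [NonUnitalRing A'] [Module ℂ A'] [IsScalarTower ℂ A' A'] [SMulCommClass ℂ A' A']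
    [NonUnitalRing B'] [Module ℂ B'] [IsScalarTower ℂ B' B'] [SMulCommClass ℂ B' B']
    [NonUnitalRing C'] [Module ℂ C'] [IsScalarTower ℂ C' C'] [SMulCommClass ℂ C' C']
    (f : A →ₙₐ[ℂ] A') (g : B →ₙₐ[ℂ] B') (h : C →ₙₐ[ℂ] C') (x : Coprod A (Coprod B C)) :
    Coprod.assoc A' B' C' (Coprod.map f (Coprod.map g h) x) =
      Coprod.map (Coprod.map f g) h (Coprod.assoc A B C x) := by
  have : (Coprod.assoc A' B' C').comp (Coprod.map f (Coprod.map g h)) =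
      (Coprod.map (Coprod.map f g) h).comp (Coprod.assoc A B C) := by
    refine Coprod.hom_ext (fun a => by simp [Coprod.assoc]) (fun y => ?_)
    have : ((Coprod.assoc A' B' C').comp (Coprod.map f (Coprod.map g h))).comp Coprod.inr =
        ((Coprod.map (Coprod.map f g) h).comp (Coprod.assoc A B C)).comp Coprod.inr :=
      Coprod.hom_ext (fun b => by simp [Coprod.assoc]) (fun c => by simp [Coprod.assoc])
    exact DFunLike.congr_fun this y
  exact DFunLike.congr_fun this x

namespace DualSemigroup

variable {D : Type u} [NonUnitalRing D] [Module ℂ D] [IsScalarTower ℂ D D] [SMulCommClass ℂ D D]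
  (S : DualSemigroup D) (m : ℕ)

/-- `Δ^{⊔ m}` as a homomorphism between free products. -/
def freeΔ : FreeProd (fun _ : Fin m => D) →ₙₐ[ℂ]
    Coprod (FreeProd fun _ : Fin m => D) (FreeProd fun _ : Fin m => D) := S.powerΔ m

theorem freeΔ_ι (k : Fin m) (a : D) :
    S.freeΔ m (FreeProd.ι (A := fun _ : Fin m => D) k a) =
      Coprod.map (FreeProd.ι (A := fun _ : Fin m => D) k)
        (FreeProd.ι (A := fun _ : Fin m => D) k) (S.Δ a) :=
  FreeProd.lift_ι (A := fun _ : Fin m => D) _ k a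

theorem freeΔ_coassoc :
    (Coprod.map (S.freeΔ m) (NonUnitalAlgHom.id ℂ _)).comp (S.freeΔ m) =
      (Coprod.assoc _ _ _).comp
        ((Coprod.map (NonUnitalAlgHom.id ℂ _) (S.freeΔ m)).comp (S.freeΔ m)) := by
  refine FreeProd.hom_ext fun k a => ?_
  have hk : (S.freeΔ m).comp (FreeProd.ι (A := fun _ : Fin m => D) k) =
      (Coprod.map (FreeProd.ι (A := fun _ : Fin m => D) k)
        (FreeProd.ι (A := fun _ : Fin m => D) k)).comp S.Δ :=
    NonUnitalAlgHom.ext fun a => S.freeΔ_ι m k a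
  have h₁ : (NonUnitalAlgHom.id ℂ (FreeProd fun _ : Fin m => D)).comp (FreeProd.ι (A := fun _ : Fin m => D) k) =
      (FreeProd.ι (A := fun _ : Fin m => D) k).comp (NonUnitalAlgHom.id ℂ D) := rfl
  have hS := DFunLike.congr_fun S.coassoc a
  simp only [NonUnitalAlgHom.comp_apply] at hS ⊢
  rw [freeΔ_ι, Coprod.map_map, Coprod.map_map, hk, h₁, ← Coprod.map_map, ← Coprod.map_map, hS,
    Coprod.assoc_map]

theorem freeΔ_counit_left :
    (Coprod.map (0 : FreeProd (fun _ : Fin m => D) →ₙₐ[ℂ] FreeProd fun _ : Fin m => D)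
      (NonUnitalAlgHom.id ℂ (FreeProd fun _ : Fin m => D))).comp (S.freeΔ m) = Coprod.inr := by
  refine FreeProd.hom_ext fun k a => ?_
  have h₀ : (0 : FreeProd (fun _ : Fin m => D) →ₙₐ[ℂ] FreeProd (fun _ : Fin m => D)).comp
      (FreeProd.ι (A := fun _ : Fin m => D) k) =
      (FreeProd.ι (A := fun _ : Fin m => D) k).comp (0 : D →ₙₐ[ℂ] D) :=
    NonUnitalAlgHom.ext fun a => by simp
  have h₁ : (NonUnitalAlgHom.id ℂ (FreeProd fun _ : Fin m => D)).comp (FreeProd.ι (A := fun _ : Fin m => D) k) =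
      (FreeProd.ι (A := fun _ : Fin m => D) k).comp (NonUnitalAlgHom.id ℂ D) := rfl
  have hS := DFunLike.congr_fun S.counit_left a
  simp only [NonUnitalAlgHom.comp_apply] at hS ⊢
  rw [freeΔ_ι, Coprod.map_map, h₀, h₁, ← Coprod.map_map, hS, Coprod.map_inr]

theorem freeΔ_counit_right :
    (Coprod.map (NonUnitalAlgHom.id ℂ (FreeProd fun _ : Fin m => D))
      (0 : FreeProd (fun _ : Fin m => D) →ₙₐ[ℂ] FreeProd fun _ : Fin m => D)).comp (S.freeΔ m) = Coprod.inl := by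
  refine FreeProd.hom_ext fun k a => ?_
  have h₀ : (0 : FreeProd (fun _ : Fin m => D) →ₙₐ[ℂ] FreeProd (fun _ : Fin m => D)).comp
      (FreeProd.ι (A := fun _ : Fin m => D) k) =
      (FreeProd.ι (A := fun _ : Fin m => D) k).comp (0 : D →ₙₐ[ℂ] D) :=
    NonUnitalAlgHom.ext fun a => by simp
  have h₁ : (NonUnitalAlgHom.id ℂ (FreeProd fun _ : Fin m => D)).comp (FreeProd.ι (A := fun _ : Fin m => D) k) =
      (FreeProd.ι (A := fun _ : Fin m => D) k).comp (NonUnitalAlgHom.id ℂ D) := rfl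
  have hS := DFunLike.congr_fun S.counit_right a
  simp only [NonUnitalAlgHom.comp_apply] at hS ⊢
  rw [freeΔ_ι, Coprod.map_map, h₀, h₁, ← Coprod.map_map, hS, Coprod.map_inl]

/-- This is what allows universality to be applied to `Δ^{⊔ m}`. -/
theorem respectsFaces_powerΔ :
    FacedAlg.RespectsFaces (FacedAlg.power m D)
      ((FacedAlg.power m D).prod (FacedAlg.power m D)) (S.powerΔ m) := by
  rintro k _ ⟨a, rfl⟩
  change S.freeΔ m (FreeProd.ι (A := fun _ : Fin m => D) k a) ∈
    FacedAlg.prodFace (FacedAlg.power m D) (FacedAlg.power m D) k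
  rw [freeΔ_ι]
  exact Coprod.map_mem (FacedAlg.prodFace (FacedAlg.power m D) (FacedAlg.power m D) k)
    (FreeProd.ι (A := fun _ : Fin m => D) k) (FreeProd.ι (A := fun _ : Fin m => D) k)
    (fun b => NonUnitalAlgebra.subset_adjoin ℂ (Or.inl ⟨_, ⟨b, rfl⟩, rfl⟩))
    (fun b => NonUnitalAlgebra.subset_adjoin ℂ (Or.inr ⟨_, ⟨b, rfl⟩, rfl⟩)) (S.Δ a)

end DualSemigroup

/-! ## The bialgebra structure -/

section Lachs

variable {d m : ℕ} {D : Type u} [NonUnitalRing D] [Module ℂ D] [IsScalarTower ℂ D D]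
  [SMulCommClass ℂ D D] (P : UAUProduct.{u} d m) (S : DualSemigroup D)

/-- The convolution product of two tuples of functionals on `D^{⊔ m}`. -/
def UAUProduct.convolution (φ₁ φ₂ : DualTuple d (FacedAlg.power m D)) :
    DualTuple d (FacedAlg.power m D) :=
  (P.prod (FacedAlg.power m D) (FacedAlg.power m D) φ₁ φ₂).comp (S.powerΔ m)

/-- On characters the comultiplication is dual to convolution. By the defining property of `σ` it
suffices to compare on the generators of the symmetric algebra. -/
theorem tensorChar_comp_lachsComul (φ₁ φ₂ : DualTuple d (FacedAlg.power m D)) :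
    (tensorChar φ₁.char φ₂.char).comp (lachsComul P S) = (P.convolution S φ₁ φ₂).char := by
  refine SymmetricAlgebra.algHom_ext (LinearMap.ext fun x => ?_)
  have h : (P.convolution S φ₁ φ₂).total x =
      (P.prod (FacedAlg.power m D) (FacedAlg.power m D) φ₁ φ₂).total
        ((S.powerΔ m : FacedAlg.power m D →ₗ[ℂ]
          (FacedAlg.power m D).prod (FacedAlg.power m D)).compLeft (Fin d) x) :=
    LinearMap.congr_fun (DualTuple.total_comp _ _) x
  change tensorChar φ₁.char φ₂.char (SymmetricAlgebra.lift _ (SymmetricAlgebra.ι ℂ _ x)) =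
    SymmetricAlgebra.lift _ (SymmetricAlgebra.ι ℂ _ x)
  rw [SymmetricAlgebra.lift_ι_apply, SymmetricAlgebra.lift_ι_apply, h]
  exact P.tensorChar_sigma _ _ φ₁ φ₂ _

/-- Universality for `Δ^{⊔ m} ⨿ id` and `id ⨿ Δ^{⊔ m}` moves the inner comultiplication out of the
product; what remains is associativity of `⊙` and coassociativity of `Δ^{⊔ m}`. -/
theorem UAUProduct.convolution_assoc (φ₁ φ₂ φ₃ : DualTuple d (FacedAlg.power m D)) :
    P.convolution S (P.convolution S φ₁ φ₂) φ₃ = P.convolution S φ₁ (P.convolution S φ₂ φ₃) := by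
  let A := FacedAlg.power m D
  have hid : FacedAlg.RespectsFaces A A (NonUnitalAlgHom.id ℂ A) := fun k a ha => ha
  have h₁ := P.universal (A.prod A) A A A (S.powerΔ m) (NonUnitalAlgHom.id ℂ A)
    (S.respectsFaces_powerΔ m) hid (P.prod A A φ₁ φ₂) φ₃
  have h₂ := P.universal A (A.prod A) A A (NonUnitalAlgHom.id ℂ A) (S.powerΔ m)
    hid (S.respectsFaces_powerΔ m) φ₁ (P.prod A A φ₂ φ₃)
  rw [← P.associative A A A φ₁ φ₂ φ₃] at h₂
  funext l
  refine LinearMap.ext fun x => ?_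
  refine (LinearMap.congr_fun (congrFun h₁ l) (S.freeΔ m x)).symm.trans
    (Eq.trans ?_ (LinearMap.congr_fun (congrFun h₂ l) (S.freeΔ m x)))
  exact congrArg (P.prod (A.prod A) A (P.prod A A φ₁ φ₂) φ₃ l)
    (DFunLike.congr_fun (S.freeΔ_coassoc m) x)

/-- Write the tuple `0` as `φ ∘ 0`. By universality `0 ⊙ φ = (φ ⊙ φ) ∘ (0 ⨿ id)`, and composing with
`Δ^{⊔ m}` restricts `φ ⊙ φ` to the second factor. -/
theorem UAUProduct.convolution_zero_left (φ : DualTuple d (FacedAlg.power m D)) :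
    P.convolution S 0 φ = φ := by
  let A := FacedAlg.power m D
  have h := P.universal A A A A 0 (NonUnitalAlgHom.id ℂ A) (fun k a _ => zero_mem (A.face k))
    (fun k a ha => ha) φ φ
  have h0 : φ.comp (0 : A →ₙₐ[ℂ] A) = 0 := funext fun l => LinearMap.ext fun x => map_zero (φ l)
  rw [h0] at h
  funext l
  refine LinearMap.ext fun x => ?_
  refine (LinearMap.congr_fun (congrFun h l) (S.freeΔ m x)).symm.trans
    (Eq.trans ?_ (LinearMap.congr_fun (congrFun (P.unital_right A A φ φ) l) x))
  exact congrArg (P.prod A A φ φ l) (DFunLike.congr_fun (S.freeΔ_counit_left m) x)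

theorem UAUProduct.convolution_zero_right (φ : DualTuple d (FacedAlg.power m D)) :
    P.convolution S φ 0 = φ := by
  let A := FacedAlg.power m D
  have h := P.universal A A A A (NonUnitalAlgHom.id ℂ A) 0 (fun k a ha => ha)
    (fun k a _ => zero_mem (A.face k)) φ φ
  have h0 : φ.comp (0 : A →ₙₐ[ℂ] A) = 0 := funext fun l => LinearMap.ext fun x => map_zero (φ l)
  rw [h0] at h
  funext l
  refine LinearMap.ext fun x => ?_
  refine (LinearMap.congr_fun (congrFun h l) (S.freeΔ m x)).symm.trans
    (Eq.trans ?_ (LinearMap.congr_fun (congrFun (P.unital_left A A φ φ) l) x))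
  exact congrArg (P.prod A A φ φ l) (DFunLike.congr_fun (S.freeΔ_counit_right m) x)

theorem char_zero_eq_lachsCounit :
    (0 : DualTuple d (FacedAlg.power m D)).char = lachsCounit d m D := by
  rw [DualTuple.char, DualTuple.total_zero, lachsCounit]

/-- Paired with characters, the axioms become associativity and the unit laws of convolution,
because the counit is the character of the tuple `0`. -/
theorem isBialgebra_lachs : IsBialgebra (lachsComul P S) (lachsCounit d m D) where
  coassoc := by
    have hs := DualTuple.isSeparating_char (d := d) (FacedAlg.power m D)
    refine (hs.tensor (hs.tensor hs)).hom_ext fun φ => ?_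
    have h₁ : (tensorChar φ.1.char (tensorChar φ.2.1.char φ.2.2.char)).comp
        ((Algebra.TensorProduct.assoc ℂ ℂ ℂ _ _ _).toAlgHom.comp
          (Algebra.TensorProduct.map (lachsComul P S) (AlgHom.id ℂ _))) =
        tensorChar ((tensorChar φ.1.char φ.2.1.char).comp (lachsComul P S)) φ.2.2.char := by
      have h : ∀ t, (tensorChar φ.1.char (tensorChar φ.2.1.char φ.2.2.char))
          (Algebra.TensorProduct.assoc ℂ ℂ ℂ _ _ _ (t ⊗ₜ 1)) =
          tensorChar φ.1.char φ.2.1.char t := fun t => by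
        induction t using TensorProduct.induction_on with
        | zero => simp
        | tmul a b => simp
        | add a b ha hb => rw [TensorProduct.add_tmul, map_add, map_add, map_add, ha, hb]
      refine Algebra.TensorProduct.ext (AlgHom.ext fun x => ?_) (AlgHom.ext fun x => ?_)
      · simpa using h (lachsComul P S x)
      · simp [Algebra.TensorProduct.one_def]
    have h₂ : (tensorChar φ.1.char (tensorChar φ.2.1.char φ.2.2.char)).comp
        (Algebra.TensorProduct.map (AlgHom.id ℂ _) (lachsComul P S)) =
        tensorChar φ.1.char ((tensorChar φ.2.1.char φ.2.2.char).comp (lachsComul P S)) :=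
      Algebra.TensorProduct.ext (AlgHom.ext fun x => by simp) (AlgHom.ext fun x => by simp)
    refine (congrArg (fun f => f.comp (lachsComul P S)) h₁).trans
      (Eq.trans ?_ (congrArg (fun f => f.comp (lachsComul P S)) h₂).symm)
    simp only [tensorChar_comp_lachsComul, UAUProduct.convolution_assoc]
  counit_left := by
    refine (DualTuple.isSeparating_char (d := d) (FacedAlg.power m D)).hom_ext fun φ => ?_
    have h : φ.char.comp ((Algebra.TensorProduct.lid ℂ _).toAlgHom.comp
        (Algebra.TensorProduct.map (lachsCounit d m D) (AlgHom.id ℂ _))) =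
        tensorChar (0 : DualTuple d (FacedAlg.power m D)).char φ.char := by
      rw [char_zero_eq_lachsCounit]
      exact Algebra.TensorProduct.ext (AlgHom.ext fun x => by simp) (AlgHom.ext fun x => by simp)
    refine (congrArg (fun f => f.comp (lachsComul P S)) h).trans ?_
    simp only [tensorChar_comp_lachsComul, UAUProduct.convolution_zero_left, AlgHom.comp_id]
  counit_right := by
    refine (DualTuple.isSeparating_char (d := d) (FacedAlg.power m D)).hom_ext fun φ => ?_
    have h : φ.char.comp ((Algebra.TensorProduct.rid ℂ ℂ _).toAlgHom.comp
        (Algebra.TensorProduct.map (AlgHom.id ℂ _) (lachsCounit d m D))) =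
        tensorChar φ.char (0 : DualTuple d (FacedAlg.power m D)).char := by
      rw [char_zero_eq_lachsCounit]
      exact Algebra.TensorProduct.ext (AlgHom.ext fun x => by simp) (AlgHom.ext fun x => by simp)
    refine (congrArg (fun f => f.comp (lachsComul P S)) h).trans ?_
    simp only [tensorChar_comp_lachsComul, UAUProduct.convolution_zero_right, AlgHom.comp_id]

end Lachs

/-! ## Gradings and eigenspaces -/

section Eigen

variable {W : Type*} [AddCommGroup W] [Module ℂ W]

theorem isInternal_of_le_eigenspace {ι : Type*} [DecidableEq ι] (𝒲 : ι → Submodule ℂ W)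
    (f : Module.End ℂ W) (μ : ι → ℂ) (hμ : Function.Injective μ)
    (h : ∀ i, 𝒲 i ≤ f.eigenspace (μ i)) (htop : ⨆ i, 𝒲 i = ⊤) : DirectSum.IsInternal 𝒲 :=
  DirectSum.isInternal_submodule_of_iSupIndep_of_iSup_eq_top
    ((f.eigenspaces_iSupIndep.comp hμ).mono h) htop

/-- Since the `𝒲 j` span, an eigenvector is the sum of a part in `𝒲 i` and a part in the other
components. The latter lies in the eigenspace for `μ i` and in the sum of the other eigenspaces, so
it is zero. -/
theorem eigenspace_le_of_le_eigenspace {ι : Type*} (𝒲 : ι → Submodule ℂ W)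
    (f : Module.End ℂ W) (μ : ι → ℂ) (hμ : Function.Injective μ)
    (h : ∀ i, 𝒲 i ≤ f.eigenspace (μ i)) (htop : ⨆ i, 𝒲 i = ⊤) (i : ι) :
    f.eigenspace (μ i) ≤ 𝒲 i := by
  intro x hx
  have hx' : x ∈ 𝒲 i ⊔ ⨆ j ≠ i, 𝒲 j := by
    have : ⨆ j, 𝒲 j ≤ 𝒲 i ⊔ ⨆ j ≠ i, 𝒲 j := iSup_le fun j => by
      by_cases e : j = i
      · subst e; exact le_sup_left
      · exact le_sup_of_le_right (le_iSup₂_of_le j e le_rfl)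
    exact this (htop ▸ Submodule.mem_top)
  obtain ⟨a, ha, b, hb, rfl⟩ := Submodule.mem_sup.1 hx'
  have hb₁ : b ∈ f.eigenspace (μ i) := by
    simpa using sub_mem hx (h i ha)
  have hb₂ : b ∈ ⨆ j ≠ i, f.eigenspace (μ j) := (iSup₂_mono fun j _ => h j) hb
  have := (f.eigenspaces_iSupIndep.comp hμ) i
  rw [Submodule.disjoint_def.1 this b hb₁ hb₂, add_zero]
  exact ha

theorem DirectSum.IsInternal.exists_linearMap {ι : Type*} [DecidableEq ι]
    {𝒲 : ι → Submodule ℂ W} (h : DirectSum.IsInternal 𝒲) {M : Type*} [AddCommGroup M] [Module ℂ M]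
    (f : ι → W →ₗ[ℂ] M) : ∃ F : W →ₗ[ℂ] M, ∀ i, ∀ w ∈ 𝒲 i, F w = f i w := by
  let e := LinearEquiv.ofBijective (DirectSum.coeLinearMap 𝒲) h
  refine ⟨DirectSum.toModule ℂ ι M (fun i => f i ∘ₗ (𝒲 i).subtype) ∘ₗ e.symm.toLinearMap,
    fun i w hw => ?_⟩
  have : e.symm w = DirectSum.lof ℂ ι (fun i => 𝒲 i) i ⟨w, hw⟩ := by
    rw [LinearEquiv.symm_apply_eq]
    exact (DirectSum.coeLinearMap_lof 𝒲 i ⟨w, hw⟩).symm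
  simp [this]

theorem injective_two_pow : Function.Injective fun n : ℕ => (2 : ℂ) ^ n := fun n k h => by
  have hcast : ((2 ^ n : ℕ) : ℂ) = (2 ^ k : ℕ) := by push_cast; exact h
  exact Nat.pow_right_injective le_rfl (Nat.cast_injective hcast)

/-- A linear map which is multiplication by `2 ^ n` on the component of degree `n`. -/
def IsDilation (𝒲 : ℕ+ → Submodule ℂ W) (θ : W → W) : Prop :=
  ∀ n, ∀ w ∈ 𝒲 n, θ w = (2 : ℂ) ^ (n : ℕ) • w

theorem IsDilation.isInternal {𝒲 : ℕ+ → Submodule ℂ W} {θ : W →ₗ[ℂ] W} (h : IsDilation 𝒲 θ)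
    (htop : ⨆ n, 𝒲 n = ⊤) : DirectSum.IsInternal 𝒲 :=
  isInternal_of_le_eigenspace 𝒲 θ (fun n => (2 : ℂ) ^ (n : ℕ))
    (injective_two_pow.comp PNat.coe_injective)
    (fun n w hw => Module.End.mem_eigenspace_iff.2 (h n w hw)) htop

theorem DirectSum.IsInternal.exists_isDilation {𝒲 : ℕ+ → Submodule ℂ W}
    (h : DirectSum.IsInternal 𝒲) : ∃ θ : W →ₗ[ℂ] W, IsDilation 𝒲 θ := by
  obtain ⟨θ, hθ⟩ := h.exists_linearMap fun n => (2 : ℂ) ^ (n : ℕ) • LinearMap.id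
  exact ⟨θ, fun n w hw => by rw [hθ n w hw]; rfl⟩

end Eigen

section Generated

variable {A : Type*} [NonUnitalRing A] [Module ℂ A]

theorem mem_generatedGrading {G : ℕ+ → Set A} {n : ℕ+} {a : A} (h : a ∈ G n) :
    a ∈ generatedGrading G n :=
  Submodule.subset_span (ProductOfDegree.of h)

variable [IsScalarTower ℂ A A] [SMulCommClass ℂ A A]

theorem mul_mem_generatedGrading {G : ℕ+ → Set A} {n k : ℕ+} {a b : A}
    (ha : a ∈ generatedGrading G n) (hb : b ∈ generatedGrading G k) :
    a * b ∈ generatedGrading G (n + k) := by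
  unfold generatedGrading at *
  induction ha, hb using Submodule.span_induction₂ with
  | mem_mem x y hx hy => exact Submodule.subset_span (ProductOfDegree.mul hx hy)
  | zero_left y _ => rw [zero_mul]; exact zero_mem _
  | zero_right x _ => rw [mul_zero]; exact zero_mem _
  | add_left x y z _ _ _ h1 h2 => rw [add_mul]; exact add_mem h1 h2
  | add_right x y z _ _ _ h1 h2 => rw [mul_add]; exact add_mem h1 h2
  | smul_left r x y _ _ h => rw [smul_mul_assoc]; exact Submodule.smul_mem _ r h
  | smul_right r x y _ _ h => rw [mul_smul_comm]; exact Submodule.smul_mem _ r h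

theorem isDilation_generatedGrading {G : ℕ+ → Set A} (θ : A →ₙₐ[ℂ] A)
    (h : ∀ n, ∀ a ∈ G n, θ a = (2 : ℂ) ^ (n : ℕ) • a) : IsDilation (generatedGrading G) θ := by
  intro n a ha
  unfold generatedGrading at ha
  induction ha using Submodule.span_induction with
  | mem a ha =>
    induction ha with
    | of ha => exact h _ _ ha
    | mul _ _ h1 h2 => rw [map_mul, h1, h2, smul_mul_smul_comm, PNat.add_coe, pow_add]
  | zero => simp
  | add x y _ _ hx hy => rw [map_add, hx, hy, smul_add]
  | smul r x _ hx => rw [map_smul, hx, smul_comm]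

/-- The sum of the components is closed under multiplication, so it is a subalgebra containing the
generators. -/
theorem iSup_generatedGrading_eq_top {G : ℕ+ → Set A}
    (h : ∀ N : NonUnitalSubalgebra ℂ A, (∀ n, ∀ a ∈ G n, a ∈ N) → ∀ a, a ∈ N) :
    ⨆ n, generatedGrading G n = ⊤ := by
  let N : NonUnitalSubalgebra ℂ A :=
    { (⨆ n, generatedGrading G n : Submodule ℂ A) with
      mul_mem' := fun {a b} (ha : a ∈ ⨆ n, generatedGrading G n)
          (hb : b ∈ ⨆ n, generatedGrading G n) => by
        change a * b ∈ ⨆ n, generatedGrading G n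
        induction ha using Submodule.iSup_induction' with
        | mem i x hx =>
          induction hb using Submodule.iSup_induction' with
          | mem j y hy => exact Submodule.mem_iSup_of_mem (i + j) (mul_mem_generatedGrading hx hy)
          | zero => rw [mul_zero]; exact zero_mem _
          | add y z _ _ hy hz => rw [mul_add]; exact add_mem hy hz
        | zero => rw [zero_mul]; exact zero_mem _
        | add x y _ _ hx hy => rw [add_mul]; exact add_mem hx hy }
  exact eq_top_iff.2 fun a _ => h N
    (fun n a ha => Submodule.mem_iSup_of_mem n (mem_generatedGrading ha)) a

theorem map_mem_generatedGrading {B : Type*} [NonUnitalRing B] [Module ℂ B]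
    {G : ℕ+ → Set B} {H : ℕ+ → Set A} (f : B →ₙₐ[ℂ] A) (h : ∀ n, ∀ a ∈ G n, f a ∈ generatedGrading H n) {n : ℕ+} {a : B}
    (ha : a ∈ generatedGrading G n) : f a ∈ generatedGrading H n := by
  unfold generatedGrading at ha
  induction ha using Submodule.span_induction with
  | mem a ha =>
    induction ha with
    | of ha => exact h _ _ ha
    | mul _ _ h1 h2 => rw [map_mul]; exact mul_mem_generatedGrading h1 h2
  | zero => rw [map_zero]; exact zero_mem _
  | add x y _ _ hx hy => rw [map_add]; exact add_mem hx hy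
  | smul r x _ hx => rw [map_smul]; exact Submodule.smul_mem _ r hx

/-- The dilation of a graded algebra is a homomorphism. -/
theorem IsGradedAlg.exists_isDilation {𝒜 : ℕ+ → Submodule ℂ A} (h : IsGradedAlg 𝒜) :
    ∃ θ : A →ₙₐ[ℂ] A, IsDilation 𝒜 θ := by
  obtain ⟨θ, hθ⟩ := h.isInternal.exists_isDilation
  have htop := h.isInternal.submodule_iSup_eq_top
  refine ⟨{ θ with map_zero' := map_zero θ, map_mul' := fun a b => ?_ }, hθ⟩
  have ha : a ∈ ⨆ n, 𝒜 n := htop ▸ Submodule.mem_top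
  have hb : b ∈ ⨆ n, 𝒜 n := htop ▸ Submodule.mem_top
  change θ (a * b) = θ a * θ b
  induction ha using Submodule.iSup_induction' with
  | mem i x hx =>
    induction hb using Submodule.iSup_induction' with
    | mem j y hy =>
      rw [hθ i x hx, hθ j y hy, hθ (i + j) _ (h.mul_mem hx hy), smul_mul_smul_comm, PNat.add_coe,
        pow_add]
    | zero => simp
    | add y z _ _ hy hz => rw [mul_add, map_add, map_add, hy, hz, mul_add]
  | zero => simp
  | add x y _ _ hx hy => rw [add_mul, map_add, map_add, hx, hy, add_mul]

end Generated

/-! ### The grading of the symmetric algebra -/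

section SymGrading

variable {W : Type*} [AddCommGroup W] [Module ℂ W] (𝒲 : ℕ+ → Submodule ℂ W)

theorem one_mem_symGrading : (1 : SymmetricAlgebra ℂ W) ∈ symGrading 𝒲 0 :=
  Submodule.subset_span ⟨0, Fin.elim0, Fin.elim0, fun i => i.elim0, by simp, by simp⟩

theorem ι_mem_symGrading {n : ℕ+} {w : W} (hw : w ∈ 𝒲 n) :
    SymmetricAlgebra.ι ℂ W w ∈ symGrading 𝒲 n :=
  Submodule.subset_span ⟨1, fun _ => n, fun _ => w, fun _ => hw, by simp, by simp⟩

theorem mul_mem_symGrading {n k : ℕ} {a b : SymmetricAlgebra ℂ W} (ha : a ∈ symGrading 𝒲 n)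
    (hb : b ∈ symGrading 𝒲 k) : a * b ∈ symGrading 𝒲 (n + k) := by
  have h := Submodule.mul_mem_mul ha hb
  rw [symGrading, symGrading, Submodule.span_mul_span] at h
  refine Submodule.span_mono ?_ h
  rintro _ ⟨_, ⟨r, e, w, hw, rfl, rfl⟩, _, ⟨s, f, v, hv, rfl, rfl⟩, rfl⟩
  refine ⟨r + s, Fin.append e f, Fin.append w v, fun i => ?_, ?_, ?_⟩
  · induction i using Fin.addCases with
    | left i => simpa using hw i
    | right i => simpa using hv i
  · simp [Fin.sum_univ_add]
  · simp [Fin.prod_univ_add]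

theorem gradedMonoid_symGrading : SetLike.GradedMonoid (symGrading 𝒲) where
  one_mem := one_mem_symGrading 𝒲
  mul_mem _ _ _ _ ha hb := mul_mem_symGrading 𝒲 ha hb

theorem iSup_symGrading_eq_top (h : ⨆ n, 𝒲 n = ⊤) : ⨆ n, symGrading 𝒲 n = ⊤ := by
  refine Submodule.eq_top_iff'.2 fun x => ?_
  induction x using SymmetricAlgebra.induction with
  | algebraMap r =>
    rw [Algebra.algebraMap_eq_smul_one]
    exact Submodule.smul_mem _ r (Submodule.mem_iSup_of_mem 0 (one_mem_symGrading 𝒲))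
  | ι w =>
    have hle : ⨆ n, 𝒲 n ≤ (⨆ n, symGrading 𝒲 n).comap (SymmetricAlgebra.ι ℂ W) :=
      iSup_le fun n w hw => Submodule.mem_iSup_of_mem (n : ℕ) (ι_mem_symGrading 𝒲 hw)
    exact hle (h ▸ Submodule.mem_top)
  | mul a b ha hb =>
    induction ha using Submodule.iSup_induction' with
    | mem i x hx =>
      induction hb using Submodule.iSup_induction' with
      | mem j y hy => exact Submodule.mem_iSup_of_mem (i + j) (mul_mem_symGrading 𝒲 hx hy)
      | zero => rw [mul_zero]; exact zero_mem _
      | add y z _ _ hy hz => rw [mul_add]; exact add_mem hy hz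
    | zero => rw [zero_mul]; exact zero_mem _
    | add x y _ _ hx hy => rw [add_mul]; exact add_mem hx hy
  | add a b ha hb => exact add_mem ha hb

/-- The endomorphism of `S(W)` given by a linear endomorphism of `W`. -/
def symMap (θ : W →ₗ[ℂ] W) : SymmetricAlgebra ℂ W →ₐ[ℂ] SymmetricAlgebra ℂ W :=
  SymmetricAlgebra.lift (SymmetricAlgebra.ι ℂ W ∘ₗ θ)

variable {𝒲}

theorem IsDilation.symMap_apply {θ : W →ₗ[ℂ] W} (h : IsDilation 𝒲 θ) {n : ℕ}
    {x : SymmetricAlgebra ℂ W} (hx : x ∈ symGrading 𝒲 n) : symMap θ x = (2 : ℂ) ^ n • x := by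
  unfold symGrading at hx
  induction hx using Submodule.span_induction with
  | mem x hx =>
    obtain ⟨r, e, w, hw, rfl, rfl⟩ := hx
    rw [map_prod, ← Finset.prod_pow_eq_pow_sum, ← Finset.prod_smul]
    refine Finset.prod_congr rfl fun i _ => ?_
    rw [symMap, SymmetricAlgebra.lift_ι_apply, LinearMap.comp_apply, h _ _ (hw i), map_smul]
  | zero => simp
  | add x y _ _ hx hy => rw [map_add, hx, hy, smul_add]
  | smul r x _ hx => rw [map_smul, hx, smul_comm]

/-- `S(θ)` acts on degree `n` as `2 ^ n`, so directness follows from independence of eigenspaces. -/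
theorem IsDilation.isInternal_symGrading {θ : W →ₗ[ℂ] W} (h : IsDilation 𝒲 θ)
    (htop : ⨆ n, 𝒲 n = ⊤) : DirectSum.IsInternal (symGrading 𝒲) :=
  isInternal_of_le_eigenspace _ (symMap θ).toLinearMap _ injective_two_pow
    (fun _ _ hx => Module.End.mem_eigenspace_iff.2 (h.symMap_apply hx))
    (iSup_symGrading_eq_top 𝒲 htop)

variable (𝒲)

/-- Generators have positive degree, so the empty product is the only one of degree `0`. -/
theorem symGrading_zero : symGrading 𝒲 0 = Submodule.span ℂ {1} := by
  refine le_antisymm (Submodule.span_le.2 ?_) ?_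
  · rintro _ ⟨r, e, w, _, he, rfl⟩
    obtain rfl : r = 0 := by
      by_contra hr
      have : (e ⟨0, Nat.pos_of_ne_zero hr⟩ : ℕ) = 0 := (Finset.sum_eq_zero_iff.1 he) _ (by simp)
      exact (e _).ne_zero this
    simp
  · rw [Submodule.span_singleton_le_iff_mem]
    exact one_mem_symGrading 𝒲

theorem lift_zero_of_mem_symGrading {n : ℕ} (hn : n ≠ 0) {x : SymmetricAlgebra ℂ W}
    (hx : x ∈ symGrading 𝒲 n) : SymmetricAlgebra.lift (0 : W →ₗ[ℂ] ℂ) x = 0 := by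
  unfold symGrading at hx
  induction hx using Submodule.span_induction with
  | mem x hx =>
    obtain ⟨r, e, w, hw, rfl, rfl⟩ := hx
    have hr : r ≠ 0 := by rintro rfl; simp at hn
    rw [map_prod]
    exact Finset.prod_eq_zero (Finset.mem_univ ⟨0, Nat.pos_of_ne_zero hr⟩) (by simp)
  | zero => simp
  | add x y _ _ hx hy => rw [map_add, hx, hy, add_zero]
  | smul r x _ hx => rw [map_smul, hx, smul_zero]

end SymGrading

/-! ### The grading of a tensor square -/

section TensorDegree

variable {B : Type*} [CommRing B] [Algebra ℂ B] {ℬ : ℕ → Submodule ℂ B}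

theorem tmul_mem_tensorDegree {n k l : ℕ} (h : k + l = n) {b c : B} (hb : b ∈ ℬ k)
    (hc : c ∈ ℬ l) : b ⊗ₜ c ∈ tensorDegree ℬ n :=
  Submodule.mem_iSup_of_mem (k, l) (Submodule.mem_iSup_of_mem
    (Finset.HasAntidiagonal.mem_antidiagonal.2 h) ⟨⟨b, hb⟩ ⊗ₜ ⟨c, hc⟩, rfl⟩)

theorem tensorDegree_le {n : ℕ} {N : Submodule ℂ (B ⊗[ℂ] B)}
    (h : ∀ k l, k + l = n → ∀ b ∈ ℬ k, ∀ c ∈ ℬ l, b ⊗ₜ c ∈ N) : tensorDegree ℬ n ≤ N := by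
  refine iSup₂_le fun p hp => ?_
  rintro _ ⟨t, rfl⟩
  induction t using TensorProduct.induction_on with
  | zero => simp
  | tmul b c => exact h p.1 p.2 (Finset.HasAntidiagonal.mem_antidiagonal.1 hp) b b.2 c c.2
  | add x y hx hy => rw [map_add]; exact add_mem hx hy

theorem iSup_tensorDegree_eq_top (h : ⨆ n, ℬ n = ⊤) : ⨆ n, tensorDegree ℬ n = ⊤ := by
  refine Submodule.eq_top_iff'.2 fun t => ?_
  induction t using TensorProduct.induction_on with
  | zero => exact zero_mem _
  | tmul b c =>
    have hb : b ∈ ⨆ n, ℬ n := h ▸ Submodule.mem_top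
    have hc : c ∈ ⨆ n, ℬ n := h ▸ Submodule.mem_top
    induction hb using Submodule.iSup_induction' with
    | mem i x hx =>
      induction hc using Submodule.iSup_induction' with
      | mem j y hy => exact Submodule.mem_iSup_of_mem (i + j) (tmul_mem_tensorDegree rfl hx hy)
      | zero => rw [TensorProduct.tmul_zero]; exact zero_mem _
      | add y z _ _ hy hz => rw [TensorProduct.tmul_add]; exact add_mem hy hz
    | zero => rw [TensorProduct.zero_tmul]; exact zero_mem _
    | add x y _ _ hx hy => rw [TensorProduct.add_tmul]; exact add_mem hx hy
  | add x y hx hy => exact add_mem hx hy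

/-- The subspaces `tensorDegree ℬ n` span and lie in the eigenspaces of `Θ ⊗ Θ` for `2 ^ n`, so they
are these eigenspaces. Homogeneity of the comultiplication thus becomes an eigenvalue equation. -/
theorem mem_tensorDegree_of_map_eq (Θ : B →ₐ[ℂ] B) (hΘ : ∀ n, ∀ b ∈ ℬ n, Θ b = (2 : ℂ) ^ n • b)
    (htop : ⨆ n, ℬ n = ⊤) {n : ℕ} {t : B ⊗[ℂ] B}
    (ht : Algebra.TensorProduct.map Θ Θ t = (2 : ℂ) ^ n • t) : t ∈ tensorDegree ℬ n := by
  refine eigenspace_le_of_le_eigenspace (tensorDegree ℬ)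
    (Algebra.TensorProduct.map Θ Θ).toLinearMap (fun n => (2 : ℂ) ^ n) injective_two_pow
    (fun n => ?_) (iSup_tensorDegree_eq_top htop) n (Module.End.mem_eigenspace_iff.2 ht)
  refine tensorDegree_le fun k l hkl b hb c hc => Module.End.mem_eigenspace_iff.2 ?_
  rw [AlgHom.toLinearMap_apply, Algebra.TensorProduct.map_tmul, hΘ k b hb, hΘ l c hc,
    TensorProduct.smul_tmul_smul, ← hkl, pow_add]

end TensorDegree

/-! ## The grading of the bialgebra -/

section LachsGrading

variable {d m : ℕ} {D : Type u} [NonUnitalRing D] [Module ℂ D] [IsScalarTower ℂ D D]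
  [SMulCommClass ℂ D D]

/-- The endomorphism of `D^{⊔ m}` given by an endomorphism of `D`. -/
def freeMap (m : ℕ) (θ : D →ₙₐ[ℂ] D) :
    FreeProd (fun _ : Fin m => D) →ₙₐ[ℂ] FreeProd (fun _ : Fin m => D) :=
  FreeProd.lift fun k => (FreeProd.ι (A := fun _ : Fin m => D) k).comp θ

theorem freeMap_ι (θ : D →ₙₐ[ℂ] D) (k : Fin m) (a : D) :
    freeMap m θ (FreeProd.ι (A := fun _ : Fin m => D) k a) =
      FreeProd.ι (A := fun _ : Fin m => D) k (θ a) :=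
  FreeProd.lift_ι (A := fun _ : Fin m => D) _ k a

theorem respectsFaces_freeMap (θ : D →ₙₐ[ℂ] D) :
    FacedAlg.RespectsFaces (FacedAlg.power m D) (FacedAlg.power m D) (freeMap m θ) := by
  rintro k _ ⟨a, rfl⟩
  exact ⟨θ a, (freeMap_ι θ k a).symm⟩

theorem IsDilation.freeMap {𝒟 : ℕ+ → Submodule ℂ D} {θ : D →ₙₐ[ℂ] D} (h : IsDilation 𝒟 θ) :
    IsDilation (W := FreeProd fun _ : Fin m => D) (powerGrading m 𝒟) (freeMap m θ) := by
  refine isDilation_generatedGrading (A := FreeProd fun _ : Fin m => D) (_root_.freeMap m θ) ?_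
  rintro n _ ⟨k, a, ha, rfl⟩
  rw [freeMap_ι, h n a ha, map_smul]

theorem iSup_powerGrading_eq_top {𝒟 : ℕ+ → Submodule ℂ D} (h : ⨆ n, 𝒟 n = ⊤) :
    ⨆ n, powerGrading m 𝒟 n = ⊤ := by
  refine iSup_generatedGrading_eq_top (A := FreeProd fun _ : Fin m => D) fun N hN =>
    FreeProd.mem_of_ι_mem N fun k a => ?_
  have hle : ⨆ n, 𝒟 n ≤ N.toSubmodule.comap
      (FreeProd.ι (A := fun _ : Fin m => D) k : D →ₗ[ℂ] FreeProd fun _ : Fin m => D) :=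
    iSup_le fun n a ha => hN n _ ⟨k, a, ha, rfl⟩
  exact hle (h ▸ Submodule.mem_top)

theorem DualSemigroup.IsGraded.map_dilation_comp_Δ {S : DualSemigroup D}
    {𝒟 : ℕ+ → Submodule ℂ D} (hS : S.IsGraded 𝒟) {θ : D →ₙₐ[ℂ] D} (hθ : IsDilation 𝒟 θ) (a : D) :
    Coprod.map θ θ (S.Δ a) = S.Δ (θ a) := by
  have hC : IsDilation (coprodGrading 𝒟) (Coprod.map θ θ) := by
    refine isDilation_generatedGrading (Coprod.map θ θ) ?_
    rintro n _ (⟨a, ha, rfl⟩ | ⟨a, ha, rfl⟩)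
    · rw [Coprod.map_inl, hθ n a ha, map_smul]
    · rw [Coprod.map_inr, hθ n a ha, map_smul]
  have ha : a ∈ ⨆ n, 𝒟 n :=
    hS.isGradedAlg.isInternal.submodule_iSup_eq_top ▸ Submodule.mem_top
  induction ha using Submodule.iSup_induction' with
  | mem n a ha => rw [hC n _ (hS.comul_mem n a ha), hθ n a ha, map_smul]
  | zero => simp
  | add x y _ _ hx hy => simp only [map_add, hx, hy]

theorem DualSemigroup.IsGraded.map_freeMap_comp_freeΔ {S : DualSemigroup D}
    {𝒟 : ℕ+ → Submodule ℂ D} (hS : S.IsGraded 𝒟) {θ : D →ₙₐ[ℂ] D} (hθ : IsDilation 𝒟 θ) :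
    (Coprod.map (freeMap m θ) (freeMap m θ)).comp (S.freeΔ m) =
      (S.freeΔ m).comp (freeMap m θ) := by
  refine FreeProd.hom_ext fun k a => ?_
  have hk : (freeMap m θ).comp (FreeProd.ι (A := fun _ : Fin m => D) k) =
      (FreeProd.ι (A := fun _ : Fin m => D) k).comp θ :=
    NonUnitalAlgHom.ext fun a => freeMap_ι θ k a
  simp only [NonUnitalAlgHom.comp_apply]
  rw [freeMap_ι, DualSemigroup.freeΔ_ι, DualSemigroup.freeΔ_ι, Coprod.map_map, hk,
    ← Coprod.map_map, hS.map_dilation_comp_Δ hθ]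

variable (P : UAUProduct.{u} d m) {S : DualSemigroup D}

/-- The endomorphism of `S((D^{⊔ m})^d)` given by an endomorphism of `D`. -/
def lachsMap (d m : ℕ) (θ : D →ₙₐ[ℂ] D) : LachsAlg d m D →ₐ[ℂ] LachsAlg d m D :=
  symMap (((freeMap m θ : FreeProd (fun _ : Fin m => D) →ₗ[ℂ] FreeProd fun _ : Fin m => D) :
    FacedAlg.power m D →ₗ[ℂ] FacedAlg.power m D).compLeft (Fin d))

theorem char_comp_lachsMap (θ : D →ₙₐ[ℂ] D) (φ : DualTuple d (FacedAlg.power m D)) :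
    φ.char.comp (lachsMap d m θ) =
      DualTuple.char (DualTuple.comp (A := FacedAlg.power m D) (B := FacedAlg.power m D) φ
        (freeMap m θ)) := by
  refine SymmetricAlgebra.algHom_ext (LinearMap.ext fun x => ?_)
  have h := LinearMap.congr_fun (DualTuple.total_comp (A := FacedAlg.power m D)
    (B := FacedAlg.power m D) φ (freeMap m θ)) x
  change SymmetricAlgebra.lift _ (SymmetricAlgebra.lift _ (SymmetricAlgebra.ι ℂ _ x)) =
    SymmetricAlgebra.lift _ (SymmetricAlgebra.ι ℂ _ x)
  rw [SymmetricAlgebra.lift_ι_apply, SymmetricAlgebra.lift_ι_apply, h]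
  exact SymmetricAlgebra.lift_ι_apply φ.total _

/-- On characters this says that convolution commutes with pulling back along `θ^{⊔ m}`. That holds
by universality, since `θ^{⊔ m}` respects the faces and commutes with `Δ^{⊔ m}`. -/
theorem DualSemigroup.IsGraded.map_lachsMap_comp_lachsComul {𝒟 : ℕ+ → Submodule ℂ D}
    (hS : S.IsGraded 𝒟) {θ : D →ₙₐ[ℂ] D} (hθ : IsDilation 𝒟 θ) :
    (Algebra.TensorProduct.map (lachsMap d m θ) (lachsMap d m θ)).comp (lachsComul P S) =
      (lachsComul P S).comp (lachsMap d m θ) := by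
  have hs := DualTuple.isSeparating_char (d := d) (FacedAlg.power m D)
  refine (hs.tensor hs).hom_ext fun φ => ?_
  have h₁ : (tensorChar φ.1.char φ.2.char).comp
      (Algebra.TensorProduct.map (lachsMap d m θ) (lachsMap d m θ)) =
      tensorChar (φ.1.char.comp (lachsMap d m θ)) (φ.2.char.comp (lachsMap d m θ)) :=
    Algebra.TensorProduct.ext (AlgHom.ext fun x => by simp) (AlgHom.ext fun x => by simp)
  refine (congrArg (fun f => f.comp (lachsComul P S)) h₁).trans (Eq.trans ?_
    (congrArg (fun f => f.comp (lachsMap d m θ))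
      (tensorChar_comp_lachsComul P S φ.1 φ.2)).symm)
  simp only [char_comp_lachsMap, tensorChar_comp_lachsComul]
  congr 1
  let A := FacedAlg.power m D
  have h₂ := P.universal A A A A (freeMap m θ) (freeMap m θ) (respectsFaces_freeMap θ)
    (respectsFaces_freeMap θ) φ.1 φ.2
  funext l
  refine LinearMap.ext fun x => ?_
  refine (LinearMap.congr_fun (congrFun h₂ l) (S.freeΔ m x)).symm.trans ?_
  exact congrArg (P.prod A A φ.1 φ.2 l) (DFunLike.congr_fun (hS.map_freeMap_comp_freeΔ hθ) x)

theorem IsDilation.pi {W : Type*} [AddCommGroup W] [Module ℂ W] {𝒲 : ℕ+ → Submodule ℂ W}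
    {θ : W →ₗ[ℂ] W} (h : IsDilation 𝒲 θ) :
    IsDilation (fun n => Submodule.pi Set.univ fun _ : Fin d => 𝒲 n) (θ.compLeft (Fin d)) :=
  fun n w hw => funext fun l => h n (w l) (hw l trivial)

theorem iSup_pi_eq_top {W : Type*} [AddCommGroup W] [Module ℂ W] {𝒲 : ℕ+ → Submodule ℂ W}
    (h : ⨆ n, 𝒲 n = ⊤) :
    ⨆ n, (Submodule.pi Set.univ fun _ : Fin d => 𝒲 n : Submodule ℂ (Fin d → W)) = ⊤ := by
  refine Submodule.eq_top_iff'.2 fun x => ?_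
  rw [← Finset.univ_sum_single x]
  refine sum_mem fun l _ => ?_
  have hle : ⨆ n, 𝒲 n ≤ (⨆ n, (Submodule.pi Set.univ fun _ : Fin d => 𝒲 n :
      Submodule ℂ (Fin d → W))).comap (LinearMap.single ℂ (fun _ => W) l) :=
    iSup_le fun n w hw => Submodule.mem_iSup_of_mem n fun k _ => by
      by_cases e : k = l
      · subst e; simpa using hw
      · simp [e]
  exact hle (h ▸ Submodule.mem_top)

theorem isGradedBialgebra_lachs {𝒟 : ℕ+ → Submodule ℂ D} (hS : S.IsGraded 𝒟) :
    IsGradedBialgebra (lachsGrading d m 𝒟) (lachsComul P S) (lachsCounit d m D) := by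
  obtain ⟨θ, hθ⟩ := hS.isGradedAlg.exists_isDilation
  have hW := IsDilation.pi (d := d) (θ := (freeMap m θ : FreeProd (fun _ : Fin m => D) →ₗ[ℂ]
    FreeProd fun _ : Fin m => D)) (hθ.freeMap (m := m))
  have htop := iSup_pi_eq_top (d := d) (iSup_powerGrading_eq_top (m := m)
    hS.isGradedAlg.isInternal.submodule_iSup_eq_top)
  exact
    { isBialgebra := isBialgebra_lachs P S
      isInternal := hW.isInternal_symGrading htop
      gradedMonoid := gradedMonoid_symGrading _
      comul_mem := fun n b hb => by
        refine mem_tensorDegree_of_map_eq (lachsMap d m θ) (fun n b hb => hW.symMap_apply hb)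
          (iSup_symGrading_eq_top _ htop) ?_
        refine (DFunLike.congr_fun (hS.map_lachsMap_comp_lachsComul P hθ) b).trans ?_
        have hb' : lachsMap d m θ b = (2 : ℂ) ^ n • b := hW.symMap_apply hb
        rw [AlgHom.comp_apply, hb', map_smul]
      counit_eq_zero := fun n hn b hb => lift_zero_of_mem_symGrading _ hn hb }

end LachsGrading

/-! ## The dual semigroup `T(V)` -/

section Tensor

variable {V : Type u} [AddCommGroup V] [Module ℂ V]

theorem NTensor.mem_of_ι_mem (N : NonUnitalSubalgebra ℂ (NTensor V)) (h : ∀ v, NTensor.ι v ∈ N)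
    (x : NTensor V) : x ∈ N := by
  obtain ⟨x, hx⟩ := x
  induction hx using NonUnitalAlgebra.adjoin_induction with
  | mem x hx => obtain ⟨v, rfl⟩ := hx; exact h v
  | add x y hx hy h1 h2 => exact N.add_mem h1 h2
  | zero => exact N.zero_mem
  | mul x y hx hy h1 h2 => exact N.mul_mem h1 h2
  | smul r x hx h1 => exact N.smul_mem r h1

/-- The dilation of `V` extends to `T(V)`, which makes the sum of the components direct. Homogeneity
of `Δ` need only be checked on `V`, where both summands of `Δ v` have the degree of `v`. -/
theorem NTensor.isGraded_dualSemigroup {𝒱 : ℕ+ → Submodule ℂ V} (h : DirectSum.IsInternal 𝒱) :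
    (NTensor.dualSemigroup V).IsGraded (NTensor.grading 𝒱) := by
  obtain ⟨θ, hθ⟩ := h.exists_isDilation
  have hT : IsDilation (NTensor.grading 𝒱) (NTensor.lift (NTensor.ι ∘ₗ θ)) := by
    refine isDilation_generatedGrading _ ?_
    rintro n _ ⟨v, hv, rfl⟩
    rw [NTensor.lift_ι, LinearMap.comp_apply, hθ n v hv, map_smul]
  have htop : ⨆ n, NTensor.grading 𝒱 n = ⊤ :=
    iSup_generatedGrading_eq_top fun N hN => NTensor.mem_of_ι_mem N fun v => by
      have hle : ⨆ n, 𝒱 n ≤ N.toSubmodule.comap NTensor.ι :=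
        iSup_le fun n v hv => hN n _ ⟨v, hv, rfl⟩
      exact hle (h.submodule_iSup_eq_top ▸ Submodule.mem_top)
  refine ⟨⟨IsDilation.isInternal (θ := (NTensor.lift (NTensor.ι ∘ₗ θ) : NTensor V →ₗ[ℂ] NTensor V))
    hT htop, mul_mem_generatedGrading⟩, fun n a ha => map_mem_generatedGrading _ ?_ ha⟩
  rintro n _ ⟨v, hv, rfl⟩
  have hv' : NTensor.ι v ∈ NTensor.grading 𝒱 n := mem_generatedGrading ⟨v, hv, rfl⟩
  change NTensor.comul V (NTensor.ι v) ∈ _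
  rw [NTensor.comul_ι]
  exact add_mem (mem_generatedGrading (Or.inl ⟨_, hv', rfl⟩))
    (mem_generatedGrading (Or.inr ⟨_, hv', rfl⟩))

end Tensor

/-! ## The antipode of a connected graded bialgebra -/

section Antipode

open WithConv

variable {B : Type*} [CommRing B] [Algebra ℂ B] {ℬ : ℕ → Submodule ℂ B}

theorem mul'_map_mem_of_mem_tensorDegree {n : ℕ} {N : Submodule ℂ B} (f g : B →ₗ[ℂ] B)
    (h : ∀ k l, k + l = n → ∀ b ∈ ℬ k, ∀ c ∈ ℬ l, f b * g c ∈ N) {t : B ⊗[ℂ] B}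
    (ht : t ∈ tensorDegree ℬ n) : LinearMap.mul' ℂ B (TensorProduct.map f g t) ∈ N :=
  tensorDegree_le (N := N.comap (LinearMap.mul' ℂ B ∘ₗ TensorProduct.map f g))
    (fun k l hkl b hb c hc => by simpa using h k l hkl b hb c hc) ht

theorem mul'_map_congr_of_mem_tensorDegree {n : ℕ} {f f' g g' : B →ₗ[ℂ] B}
    (hf : ∀ k ≤ n, ∀ b ∈ ℬ k, f b = f' b) (hg : ∀ k ≤ n, ∀ b ∈ ℬ k, g b = g' b) {t : B ⊗[ℂ] B}
    (ht : t ∈ tensorDegree ℬ n) :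
    LinearMap.mul' ℂ B (TensorProduct.map f g t) =
      LinearMap.mul' ℂ B (TensorProduct.map f' g' t) := by
  have : tensorDegree ℬ n ≤ LinearMap.eqLocus (LinearMap.mul' ℂ B ∘ₗ TensorProduct.map f g)
      (LinearMap.mul' ℂ B ∘ₗ TensorProduct.map f' g') :=
    tensorDegree_le fun k l hkl b hb c hc => by
      simp [hf k (by omega) b hb, hg l (by omega) c hc]
  exact this ht

/-- A graded bialgebra whose component of degree `0` consists of the multiples of the unit has an
antipode, and the antipode is homogeneous of degree `0`. -/
theorem IsGradedBialgebra.isGradedHopfAlgebra {Δ : B →ₐ[ℂ] B ⊗[ℂ] B} {ε : B →ₐ[ℂ] ℂ}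
    (h : IsGradedBialgebra ℬ Δ ε) (h0 : ℬ 0 = Submodule.span ℂ {1}) :
    IsGradedHopfAlgebra ℬ Δ ε := by
  have hl : (Algebra.TensorProduct.map ε (AlgHom.id ℂ B)).comp Δ =
      (Algebra.TensorProduct.lid ℂ B).symm := AlgHom.ext fun b =>
    (AlgEquiv.eq_symm_apply _).2 (DFunLike.congr_fun h.isBialgebra.counit_left b)
  have hr : (Algebra.TensorProduct.map (AlgHom.id ℂ B) ε).comp Δ =
      (Algebra.TensorProduct.rid ℂ ℂ B).symm := AlgHom.ext fun b =>
    (AlgEquiv.eq_symm_apply _).2 (DFunLike.congr_fun h.isBialgebra.counit_right b)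
  -- This supplies the convolution ring of linear endomorphisms of `B`, whose unit is `ε` followed
  -- by the embedding of scalars. An antipode is a two-sided inverse of the identity map `1 - x` in
  -- this ring.
  let _ : Bialgebra ℂ B := Bialgebra.ofAlgHom Δ ε h.isBialgebra.coassoc hl hr
  have hmul : ∀ (f g : WithConv (B →ₗ[ℂ] B)) (b : B),
      (f * g).ofConv b = LinearMap.mul' ℂ B (TensorProduct.map f.ofConv g.ofConv (Δ b)) :=
    fun f g b => rfl
  have hone : ∀ b : B, (1 : WithConv (B →ₗ[ℂ] B)).ofConv b = algebraMap ℂ B (ε b) := fun b => rfl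
  have hone_mem : (1 : B) ∈ ℬ 0 := h0 ▸ Submodule.mem_span_singleton_self 1
  let x : WithConv (B →ₗ[ℂ] B) := 1 - toConv LinearMap.id
  have hx : ∀ b, x.ofConv b = algebraMap ℂ B (ε b) - b := fun b => rfl
  have hx0 : ∀ b ∈ ℬ 0, x.ofConv b = 0 := fun b hb => by
    rw [h0] at hb
    obtain ⟨r, rfl⟩ := Submodule.mem_span_singleton.1 hb
    rw [hx, map_smul, map_one, smul_eq_mul, mul_one, Algebra.algebraMap_eq_smul_one, sub_self]
  have hpow_mem : ∀ k n, ∀ b ∈ ℬ n, (x ^ k).ofConv b ∈ ℬ n := by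
    have h1 : ∀ n, ∀ b ∈ ℬ n, algebraMap ℂ B (ε b) ∈ ℬ n := fun n b hb => by
      rcases eq_or_ne n 0 with rfl | hn
      · rw [Algebra.algebraMap_eq_smul_one]
        exact Submodule.smul_mem _ _ hone_mem
      · rw [h.counit_eq_zero n hn b hb, map_zero]
        exact zero_mem _
    intro k
    induction k with
    | zero => intro n b hb; rw [pow_zero, hone]; exact h1 n b hb
    | succ k ih =>
      intro n b hb
      rw [pow_succ, hmul]
      refine mul'_map_mem_of_mem_tensorDegree _ _ (fun i j hij a ha c hc => ?_)
        (h.comul_mem n b hb)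
      rw [← hij]
      refine h.gradedMonoid.mul_mem (ih i a ha) ?_
      rw [hx]
      exact sub_mem (h1 j c hc) hc
  -- Since `x` vanishes in degree `0`, the last factor must consume at least one degree, which
  -- leaves too little for the other `k` factors.
  have hpow_zero : ∀ k n, n < k → ∀ b ∈ ℬ n, (x ^ k).ofConv b = 0 := by
    intro k
    induction k with
    | zero => intro n hn; omega
    | succ k ih =>
      intro n hn b hb
      rw [pow_succ, hmul, ← Submodule.mem_bot ℂ]
      refine mul'_map_mem_of_mem_tensorDegree _ _ (fun i j hij a ha c hc => ?_)
        (h.comul_mem n b hb)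
      rw [Submodule.mem_bot]
      rcases eq_or_ne j 0 with rfl | hj
      · rw [hx0 c hc, mul_zero]
      · rw [ih i (by omega) a ha, zero_mul]
  let s : ℕ → WithConv (B →ₗ[ℂ] B) := fun n => ∑ k ∈ Finset.range (n + 1), x ^ k
  have hs : ∀ n b, (s n).ofConv b = ∑ k ∈ Finset.range (n + 1), (x ^ k).ofConv b := fun n b => by
    simp [s, ofConv_sum]
  have hs_eq : ∀ n N, n ≤ N → ∀ b ∈ ℬ n, (s n).ofConv b = (s N).ofConv b := fun n N hn b hb => by
    rw [hs, hs]
    refine Finset.sum_subset (Finset.range_mono (by omega)) fun k _ hk => ?_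
    exact hpow_zero k n (by simpa using hk) b hb
  -- The full geometric series: on degree `n` the terms beyond `x ^ n` vanish, so the partial sum `s
  -- n` suffices.
  obtain ⟨α, hα⟩ := h.isInternal.exists_linearMap fun n => (s n).ofConv
  have hid : (1 : WithConv (B →ₗ[ℂ] B)) - x = toConv LinearMap.id := sub_sub_cancel _ _
  have hext : ∀ f g : B →ₗ[ℂ] B, (∀ n, ∀ b ∈ ℬ n, f b = g b) → f = g := fun f g hfg => by
    have hle : ⨆ n, ℬ n ≤ LinearMap.eqLocus f g := iSup_le fun n b hb => hfg n b hb
    exact LinearMap.ext fun b => hle (h.isInternal.submodule_iSup_eq_top ▸ Submodule.mem_top)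
  refine ⟨h, α, hext _ _ fun n b hb => ?_, hext _ _ fun n b hb => ?_, fun n b hb => ?_⟩
  -- On degree `n` the error `x ^ (n + 1)` vanishes, and `Δ b` involves only degrees at most `n`,
  -- where `α` agrees with `s n`.
  · have h₁ : s n * toConv LinearMap.id = 1 - x ^ (n + 1) := by
      rw [← hid]; exact geom_sum_mul_neg x (n + 1)
    have h₂ := hmul (s n) (toConv LinearMap.id) b
    rw [h₁, ofConv_sub, LinearMap.sub_apply, hpow_zero (n + 1) n (by omega) b hb, sub_zero,
      hone] at h₂
    exact (mul'_map_congr_of_mem_tensorDegree (fun k hk c hc => (hα k c hc).trans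
      (hs_eq k n hk c hc)) (fun _ _ _ _ => rfl) (h.comul_mem n b hb)).trans h₂.symm
  · have h₁ : toConv LinearMap.id * s n = 1 - x ^ (n + 1) := by
      rw [← hid]; exact mul_neg_geom_sum x (n + 1)
    have h₂ := hmul (toConv LinearMap.id) (s n) b
    rw [h₁, ofConv_sub, LinearMap.sub_apply, hpow_zero (n + 1) n (by omega) b hb, sub_zero,
      hone] at h₂
    exact (mul'_map_congr_of_mem_tensorDegree (fun _ _ _ _ => rfl) (fun k hk c hc =>
      (hα k c hc).trans (hs_eq k n hk c hc)) (h.comul_mem n b hb)).trans h₂.symm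
  · rw [hα n b hb, hs]
    exact sum_mem fun k _ => hpow_mem k n b hb

end Antipode

end

theorem mainTheorem5 {d m : ℕ} (P : UAUProduct.{u} d m) :
    (∀ (D : Type u) [NonUnitalRing D] [Module ℂ D] [IsScalarTower ℂ D D] [SMulCommClass ℂ D D]
      (S : DualSemigroup D) (𝒟 : ℕ+ → Submodule ℂ D), S.IsGraded 𝒟 →
      (∃! σ, P.IsSigma (FacedAlg.power m D) (FacedAlg.power m D) σ) ∧
      IsGradedBialgebra (lachsGrading d m 𝒟) (lachsComul P S) (lachsCounit d m D)) ∧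
    (∀ (V : Type u) [AddCommGroup V] [Module ℂ V] (𝒱 : ℕ+ → Submodule ℂ V),
      DirectSum.IsInternal 𝒱 →
      (NTensor.dualSemigroup V).IsGraded (NTensor.grading 𝒱) ∧
      IsGradedHopfAlgebra (lachsGrading d m (NTensor.grading 𝒱))
        (lachsComul P (NTensor.dualSemigroup V)) (lachsCounit d m (NTensor V)) ∧
      lachsGrading d m (NTensor.grading 𝒱) 0 = Submodule.span ℂ {1}) := by
  refine ⟨fun D _ _ _ _ S 𝒟 hS => ⟨P.existsUnique_isSigma _ _, isGradedBialgebra_lachs P hS⟩,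
    fun V _ _ 𝒱 h𝒱 => ?_⟩
  have hV := NTensor.isGraded_dualSemigroup h𝒱
  have h0 : lachsGrading d m (NTensor.grading 𝒱) 0 = Submodule.span ℂ {1} := symGrading_zero _
  exact ⟨hV, (isGradedBialgebra_lachs P hV).isGradedHopfAlgebra h0, h0⟩
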